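/- Let $\mathfrak D=\{x+iy: x,y\in[-1/2,1/2)\}$ and $\mathfrak D^*=\mathfrak D\setminus\{0\}$. For $z\in\mathbb C$ let $[z]$ be the Gaussian integer with $z-[z]\in\mathfrak D$. For $z\in\mathfrak D^*$ put $T(z)=1/z-[1/z]$ and let $a_n(z)=[1/T^{n-1}(z)]$, $n\ge1$, be the partial quotients of the Hurwitz continued fraction of $z$; the sequence is infinite if $z\notin\mathbb Q(i)$, and it stops at the first $N$ with $T^N(z)=0$ if $z\in\mathbb Q(i)$. For $z\in\mathfrak D^*\setminus\mathbb Q(i)$ and $p/q\in\mathfrak D^*\cap\mathbb Q(i)$ with partial quotients $(b_1,\dots,b_N)$ let $$d(z,p/q)=\#\{n: 1\le n\le N,\ a_n(z)\ne b_n\}.$$ Let $\psi\colon(0,\infty)\to(0,\infty)$ be nonincreasing with $\lim_{x\to\infty}\psi(x)=0$, and let $$\lambda(\psi)=\liminf_{x\to\infty}\frac{-\log\psi(x)}{\log x}\in[0,\infty].$$ Let $E(\psi)$ be the set of all $z\in\mathfrak D^*\setminus\mathbb Q(i)$ for which there are infinitely many distinct fractions $p^{(n)}/q^{(n)}\in\mathfrak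 D^*\cap\mathbb Q(i)$, $n\ge1$, with $p^{(n)},q^{(n)}\in\mathbb Z[i]$, $q^{(n)}\ne0$, such that $|z-p^{(n)}/q^{(n)}|\le\psi(|q^{(n)}|)$ for all $n$ and $d(z,p^{(n)}/q^{(n)})\to\infty$ as $n\to\infty$. Then $$\dim_{\mathrm H}E(\psi)=\min\bigl(4/\lambda(\psi),\,2\bigr)\qquad\text{and}\qquad \dim_{\mathrm P}E(\psi)=2,$$ where $\dim_{\mathrm H}$ and $\dim_{\mathrm P}$ denote Hausdorff and packing dimension, $4/0=\infty$ and $4/\infty=0$. -/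

import Mathlib

open Filter Topology

noncomputable section

namespace Hurwitz

/-! ### Hurwitz continued fractions -/

/-- The Hurwitz fundamental domain `{x + iy : x, y ∈ [-1/2, 1/2)}`. -/
def domain : Set ℂ :=
  {z | -(1 / 2) ≤ z.re ∧ z.re < 1 / 2 ∧ -(1 / 2) ≤ z.im ∧ z.im < 1 / 2}

/-- The fundamental domain without the origin. -/
def domainStar : Set ℂ := domain \ {0}

/-- The nearest Gaussian integer `[z]`. -/
def nearest (z : ℂ) : GaussianInt := ⟨⌊z.re + 1 / 2⌋, ⌊z.im + 1 / 2⌋⟩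

/-- `[z]` is characterized by `z - [z]` lying in the fundamental domain. -/
theorem eq_nearest_iff (z : ℂ) (a : GaussianInt) :
    a = nearest z ↔ z - (a : ℂ) ∈ domain := by
  have h : ∀ (x : ℝ) (n : ℤ), n = ⌊x + 1 / 2⌋ ↔ -(1 / 2) ≤ x - n ∧ x - n < 1 / 2 := by
    intro x n
    rw [eq_comm, Int.floor_eq_iff]
    constructor <;> rintro ⟨h1, h2⟩ <;> constructor <;> linarith
  simp only [nearest, domain, Zsqrtd.ext_iff, h, Set.mem_ofPred_eq, Complex.sub_re, Complex.sub_im,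
    ← GaussianInt.intCast_re, ← GaussianInt.intCast_im, and_assoc]

/-- The Hurwitz map `T(z) = 1/z - [1/z]`. With `1/0 = 0` this gives `T(0) = 0`. -/
def T (z : ℂ) : ℂ := 1 / z - (nearest (1 / z) : ℂ)

/-- The `n`-th partial quotient `a_n(z) = [1 / T^{n-1}(z)]`, for `n ≥ 1`. It is meaningful only as
long as `T^{n-1}(z) ≠ 0`. -/
def partialQuotient (z : ℂ) (n : ℕ) : GaussianInt := nearest (1 / T^[n - 1] z)

/-- The number `N` of partial quotients of an element of `ℚ(i)`: the first `N` with
`T^N(w) = 0`. -/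
def expansionLength (w : ℂ) : ℕ := sInf {N : ℕ | T^[N] w = 0}

/-- The number of `n` with `1 ≤ n ≤ N` and `a_n(z) ≠ a_n(w)`, where `N` is the number of partial
quotients of `w ∈ ℚ(i)`, and `z ∉ ℚ(i)`. -/
def diffCount (z w : ℂ) : ℕ :=
  {n : ℕ | 1 ≤ n ∧ n ≤ expansionLength w ∧ partialQuotient z n ≠ partialQuotient w n}.ncard

/-- The field `ℚ(i)` as a subset of `ℂ`. -/
def rationals : Set ℂ := {w | ∃ p q : GaussianInt, q ≠ 0 ∧ w = (p : ℂ) / (q : ℂ)}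

/-- The set `E(ψ)`: irrational `z` in the fundamental domain with infinitely many (pairwise
different) approximations `p_n / q_n` such that `|z - p_n/q_n| ≤ ψ(|q_n|)`, and such that the
number of places where the partial quotients of `z` and of `p_n/q_n` differ tends to infinity.
Since partial quotients are those of points of the punctured fundamental domain,
the `p_n / q_n` are taken there. -/
def E (ψ : ℝ → ℝ) : Set ℂ :=
  {z | z ∈ domainStar ∧ z ∉ rationals ∧
    ∃ p q : ℕ → GaussianInt,
      (∀ n, q n ≠ 0) ∧
      Function.Injective (fun n => (p n : ℂ) / (q n : ℂ)) ∧
      (∀ n, (p n : ℂ) / (q n : ℂ) ∈ domainStar) ∧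
      (∀ n, ‖z - (p n : ℂ) / (q n : ℂ)‖ ≤ ψ ‖(q n : ℂ)‖) ∧
      Tendsto (fun n => diffCount z ((p n : ℂ) / (q n : ℂ))) atTop atTop}

/-! ### The lower order -/

/-- `λ(ψ) = liminf_{x → ∞} (-log ψ(x)) / log x`, which may be `+∞`. -/
def lowerOrder (ψ : ℝ → ℝ) : EReal :=
  liminf (fun x : ℝ => ((-Real.log (ψ x) / Real.log x : ℝ) : EReal)) atTop

/-- The lower order of a positive function tending to `0` is nonnegative, so that it may be
regarded as an element of `[0, ∞]`. -/
theorem lowerOrder_nonneg (ψ : ℝ → ℝ) (hpos : ∀ x, 0 < x → 0 < ψ x)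
    (hlim : Tendsto ψ atTop (𝓝 0)) : 0 ≤ lowerOrder ψ := by
  refine le_liminf_of_le (h := ?_)
  filter_upwards [hlim.eventually_lt_const one_pos, eventually_ge_atTop 1] with x h1 hx
  have h2 : Real.log (ψ x) ≤ 0 := Real.log_nonpos (hpos x (by linarith)).le h1.le
  exact_mod_cast div_nonneg (by linarith) (Real.log_nonneg hx)

end Hurwitz

/-! ### Packing measure and packing dimension in the plane -/

namespace Packing

/-- A `δ`-packing of `F`: a countable family of pairwise disjoint closed balls with centers in `F`
and radii in `(0, δ]`, each ball being given by its center and radius. -/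
def IsPacking (δ : ℝ) (F : Set ℂ) (S : Set (ℂ × ℝ)) : Prop :=
  S.Countable ∧ (∀ b ∈ S, b.1 ∈ F ∧ 0 < b.2 ∧ b.2 ≤ δ) ∧
    S.PairwiseDisjoint (fun b => Metric.closedBall b.1 b.2)

/-- `P^s_δ(F)`: the supremum of `∑ |B|^s` over all `δ`-packings of `F`, where `|B|` is the
diameter of the ball `B`. -/
def preSize (s δ : ℝ) (F : Set ℂ) : ENNReal :=
  ⨆ (S : Set (ℂ × ℝ)) (_ : IsPacking δ F S), ∑' b : S, ENNReal.ofReal (2 * b.1.2) ^ s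

/-- The `s`-dimensional packing premeasure `lim_{δ → 0} P^s_δ(F)`; as `P^s_δ(F)` is monotone
in `δ`, the limit is an infimum. -/
def premeasure (s : ℝ) (F : Set ℂ) : ENNReal :=
  ⨅ (δ : ℝ) (_ : 0 < δ), preSize s δ F

/-- The `s`-dimensional packing measure of `F`. -/
def packingMeasure (s : ℝ) (F : Set ℂ) : ENNReal :=
  ⨅ (G : ℕ → Set ℂ) (_ : F ⊆ ⋃ i, G i), ∑' i, premeasure s (G i)

/-- The packing dimension: the supremum of the `s ≥ 0` with infinite `s`-dimensional packing
measure. -/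
def dimP (F : Set ℂ) : ENNReal :=
  ⨆ (s : NNReal) (_ : packingMeasure (s : ℝ) F = ⊤), (s : ENNReal)

end Packing

end

/-! The bound `dimH_E_le` is the usual covering argument: the fractions lie in the unit disc, so
`|p| ≤ |q|`, and the sum of `|q| ^ (-t s)` over all pairs converges for `t s > 4`.

The other bounds rest on one local fact (`exists_good_ball`): near almost every `x`, at a scale `Q`
where the denominators of `x` do not jump, there is a fraction `P` with denominator `≲ Q` at
distance `≲ Q⁻²` from `x`, and within distance `τ` of `P` a ball of radius `τ / 512` on which at
least `m` partial quotients differ from those of `P`. It has two sources. (1) The unit circles about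
Gaussian integers cut the square into finitely many cells that form a Markov partition for `T`. Each
cell contains a full cylinder of order one or two, so near `x` some iterate of `T` has a Möbius
inverse branch on the whole open square, with bounded distortion (`exists_full_chart`). (2) Some
rational `R` lies on the border of two digits, so that on one side of it all of the first `m` digits
differ from those of `R` (`exists_tangent_rational`). The reason is that left and right edge points
of the square are mirror images, and reflection replaces each digit by minus its conjugate. Inverse
branches transport `R` to `P`.

Hence each `goodSet ψ m` contains many balls of radius comparable to `Q ^ (-l)` for suitable `Q`.
For `l s < 4` they are numerous enough that a cover of `E ψ` with small `s`-sum always leaves a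
nested sequence of balls essentially uncovered (`exists_smaller_ball`, `hausdorffMeasure_ne_zero`).
For the packing dimension, the good sets have dense interior in the square, so `E ψ` is residual
there and some member of every countable cover is dense in a ball (`exists_dense_in_ball`), which
forces infinite premeasure in every dimension below 2. -/

noncomputable section
namespace Hurwitz

/-! ### The cells of the Hurwitz map -/

/-- The interior of the fundamental domain. -/
def openDomain : Set ℂ := {z | |z.re| < 1 / 2 ∧ |z.im| < 1 / 2}

/-- Interior points of the fundamental domain that are on none of the unit circles centered at
Gaussian integers. -/
def generic : Set ℂ := {w | w ∈ openDomain ∧ ∀ c : GaussianInt, ‖w - c‖ ≠ 1}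

/-- The generic points that lie in the same unit discs around Gaussian integers as `w`. -/
def cell (w : ℂ) : Set ℂ :=
  {w' | w' ∈ generic ∧ ∀ c : GaussianInt, ‖w' - c‖ < 1 ↔ ‖w - c‖ < 1}

lemma openDomain_subset_domain : openDomain ⊆ domain := by
  intro z hz
  obtain ⟨h1, h2⟩ := hz
  rw [abs_lt] at h1 h2
  exact ⟨h1.1.le, h1.2, h2.1.le, h2.2⟩

lemma isOpen_openDomain : IsOpen openDomain := by
  have h1 : IsOpen {z : ℂ | |z.re| < 1 / 2} := isOpen_lt (by fun_prop) continuous_const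
  have h2 : IsOpen {z : ℂ | |z.im| < 1 / 2} := isOpen_lt (by fun_prop) continuous_const
  exact h1.inter h2

lemma T_mem_domain (z : ℂ) : T z ∈ domain := (eq_nearest_iff (1 / z) _).1 rfl

lemma iterate_T_mem_domain {z : ℂ} (hz : z ∈ domain) (n : ℕ) : T^[n] z ∈ domain := by
  cases n with
  | zero => exact hz
  | succ n => rw [Function.iterate_succ_apply']; exact T_mem_domain _

lemma normSq_le_of_mem_domain {z : ℂ} (hz : z ∈ domain) : Complex.normSq z ≤ 1 / 2 := by
  obtain ⟨h1, h2, h3, h4⟩ := hz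
  rw [Complex.normSq_apply]
  nlinarith

lemma two_mul_norm_sq_le {z : ℂ} (hz : z ∈ domain) : 2 * ‖z‖ ^ 2 ≤ 1 := by
  have := normSq_le_of_mem_domain hz
  rw [Complex.normSq_eq_norm_sq] at this
  linarith

lemma norm_le_of_mem_domain {z : ℂ} (hz : z ∈ domain) : ‖z‖ ≤ 71 / 100 := by
  have := two_mul_norm_sq_le hz
  nlinarith [norm_nonneg z]

lemma nearest_add {a : GaussianInt} {w : ℂ} (hw : w ∈ domain) : nearest (a + w) = a := by
  symm
  rw [eq_nearest_iff]
  simpa using hw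

lemma T_inv_add {a : GaussianInt} {w : ℂ} (hw : w ∈ domain) : T ((a + w)⁻¹) = w := by
  rw [T, one_div, inv_inv, nearest_add hw]
  ring

lemma inv_eq_nearest_add_T (z : ℂ) : z⁻¹ = nearest (1 / z) + T z := by
  rw [T]; simp

lemma norm_lt_one_iff_normSq (z : ℂ) : ‖z‖ < 1 ↔ Complex.normSq z < 1 := by
  rw [Complex.normSq_eq_norm_sq]
  constructor
  · intro h; nlinarith [norm_nonneg z]
  · intro h; nlinarith [norm_nonneg z]

lemma norm_eq_one_iff_normSq (z : ℂ) : ‖z‖ = 1 ↔ Complex.normSq z = 1 := by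
  rw [Complex.normSq_eq_norm_sq]
  constructor
  · intro h; rw [h]; norm_num
  · intro h; nlinarith [norm_nonneg z]

lemma normSq_inv_sub {u : ℂ} (hu : u ≠ 0) (c : ℂ) :
    (Complex.normSq (u⁻¹ - c) - 1) * Complex.normSq u =
      (Complex.normSq c - 1) * Complex.normSq u - 2 * (c * u).re + 1 := by
  have h : u⁻¹ - c = (1 - c * u) * u⁻¹ := by field_simp
  rw [h, map_mul, Complex.normSq_inv, sub_mul, mul_assoc, inv_mul_cancel₀ (by simpa using hu)]
  simp [Complex.normSq_apply]
  ring

/-- Inversion sends a unit circle through the origin to a line. For a Gaussian unit `c` this line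
carries a side of the square. -/
lemma norm_inv_sub_unit {u c : ℂ} (hu : u ≠ 0) (hc : Complex.normSq c = 1) :
    (‖u⁻¹ - c‖ < 1 ↔ 1 / 2 < (c * u).re) ∧ (‖u⁻¹ - c‖ = 1 ↔ (c * u).re = 1 / 2) := by
  have h := normSq_inv_sub hu c
  have hp : 0 < Complex.normSq u := Complex.normSq_pos.2 hu
  rw [norm_lt_one_iff_normSq, norm_eq_one_iff_normSq]
  rw [hc] at h
  refine ⟨⟨fun h1 => by nlinarith, fun h1 => by nlinarith⟩, ⟨fun h1 => ?_, fun h1 => ?_⟩⟩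
  · rw [h1] at h; linarith
  · have : (Complex.normSq (u⁻¹ - c) - 1) * Complex.normSq u = 0 := by rw [h, h1]; ring
    rcases mul_eq_zero.1 this with h2 | h2
    · linarith
    · exact absurd h2 hp.ne'

/-- Since `|c|² = 1 + 1`, the circle is orthogonal to the unit circle about 0 and is preserved by
reflection in it; `z ↦ 1/z` is this reflection followed by conjugation. -/
lemma norm_inv_sub_corner {u c : ℂ} (hu : u ≠ 0) (hc : Complex.normSq c = 2) :
    (‖u⁻¹ - c‖ < 1 ↔ ‖u - star c‖ < 1) ∧ (‖u⁻¹ - c‖ = 1 ↔ ‖u - star c‖ = 1) := by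
  have h := normSq_inv_sub hu c
  have hp : 0 < Complex.normSq u := Complex.normSq_pos.2 hu
  have h2 : Complex.normSq (u - star c) - 1 = (Complex.normSq (u⁻¹ - c) - 1) * Complex.normSq u := by
    rw [h]
    have h3 : Complex.normSq (u - star c) =
      Complex.normSq u + Complex.normSq c - 2 * (c * u).re := by
      simp [Complex.normSq_apply]; ring
    rw [h3, hc]; ring
  simp only [norm_lt_one_iff_normSq, norm_eq_one_iff_normSq]
  refine ⟨⟨fun h1 => by nlinarith, fun h1 => ?_⟩, ⟨fun h1 => ?_, fun h1 => ?_⟩⟩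
  · by_contra h4
    nlinarith
  · rw [h1] at h2; linarith
  · rw [h1, sub_self] at h2
    rcases mul_eq_zero.1 h2.symm with h3 | h3
    · linarith
    · exact absurd h3 hp.ne'

lemma normSq_coe (c : GaussianInt) : Complex.normSq (c : ℂ) = (c.norm : ℝ) :=
  (GaussianInt.intCast_real_norm c).symm

/-- A point whose inverse satisfies the relations that define a cell lies in that cell. -/
lemma inv_mem_cell {u u' : ℂ} (hu : u⁻¹ ∈ generic)
    (h1 : ∀ c : GaussianInt, c.norm = 1 → 1 < ‖u' - c‖)
    (h2 : ∀ c : GaussianInt, c.norm = 2 → (‖u' - c‖ < 1 ↔ ‖u - c‖ < 1) ∧ ‖u' - c‖ ≠ 1)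
    (h3 : ∀ c : GaussianInt, c.norm = 1 →
      (1 / 2 < ((c : ℂ) * u').re ↔ 1 / 2 < ((c : ℂ) * u).re) ∧ ((c : ℂ) * u').re ≠ 1 / 2) :
    u'⁻¹ ∈ cell u⁻¹ := by
  have hu0 : u ≠ 0 := by
    rintro rfl
    have := hu.2 1
    simp at this
  have hu'0 : u' ≠ 0 := by
    rintro rfl
    have := h1 1 (by decide)
    simp at this
  -- The sides of the square invert to the unit circles about the four units, so `h1` puts `u'⁻¹` in
  -- the open square.
  have key : ∀ x y : ℤ, (⟨x, y⟩ : GaussianInt).norm = 1 →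
      ((⟨x, y⟩ : GaussianInt) * u'⁻¹).re < 1 / 2 := by
    intro x y hxy
    by_contra hcon
    push Not at hcon
    have hb : Complex.normSq ((⟨x, y⟩ : GaussianInt) : ℂ) = 1 := by rw [normSq_coe, hxy]; simp
    have h5 := norm_inv_sub_unit (inv_ne_zero hu'0) hb
    rw [inv_inv] at h5
    have hc : ‖u' - ((⟨x, y⟩ : GaussianInt) : ℂ)‖ ≤ 1 := by
      rcases hcon.lt_or_eq with h | h
      · exact (h5.1.2 h).le
      · exact (h5.2.2 h.symm).le
    have := h1 ⟨x, y⟩ hxy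
    linarith
  have hop : u'⁻¹ ∈ openDomain := by
    have e1 := key 1 0 (by decide)
    have e2 := key (-1) 0 (by decide)
    have e3 := key 0 1 (by decide)
    have e4 := key 0 (-1) (by decide)
    simp only [Complex.mul_re, GaussianInt.re_toComplex, GaussianInt.im_toComplex, Int.cast_one,
      Int.cast_zero, Int.cast_neg] at e1 e2 e3 e4
    constructor <;> rw [abs_lt] <;> constructor <;> linarith
  have main : ∀ c : GaussianInt, (‖u'⁻¹ - c‖ < 1 ↔ ‖u⁻¹ - c‖ < 1) ∧ ‖u'⁻¹ - c‖ ≠ 1 := by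
    intro c
    have hn : 0 ≤ c.norm := GaussianInt.norm_nonneg c
    -- Only centers of norm 1 and 2 cut the square: the disc about 0 contains it, and centers of
    -- norm at least 3 are too far away, as `√3 - 0.71 > 1`.
    rcases (by omega : c.norm = 0 ∨ c.norm = 1 ∨ c.norm = 2 ∨ 3 ≤ c.norm) with h | h | h | h
    · rw [GaussianInt.norm_eq_zero] at h
      subst h
      have e1 := norm_le_of_mem_domain (openDomain_subset_domain hop)
      have e2 := norm_le_of_mem_domain (openDomain_subset_domain hu.1)
      simp only [GaussianInt.toComplex_zero, sub_zero]
      exact ⟨⟨fun _ => by linarith, fun _ => by linarith⟩, fun h => by linarith⟩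
    · have hc : Complex.normSq (c : ℂ) = 1 := by rw [normSq_coe, h]; simp
      rw [(norm_inv_sub_unit hu'0 hc).1, (norm_inv_sub_unit hu0 hc).1, Ne,
        (norm_inv_sub_unit hu'0 hc).2]
      exact h3 c h
    · have hc : Complex.normSq (c : ℂ) = 2 := by rw [normSq_coe, h]; simp
      rw [(norm_inv_sub_corner hu'0 hc).1, (norm_inv_sub_corner hu0 hc).1, Ne,
        (norm_inv_sub_corner hu'0 hc).2]
      have e : star (c : ℂ) = ((star c : GaussianInt) : ℂ) := (GaussianInt.toComplex_star c).symm
      rw [e]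
      exact h2 (star c) (by rw [Zsqrtd.norm_conj, h])
    · have far : ∀ z ∈ openDomain, 1 < ‖z - c‖ := by
        intro z hz
        have e1 := norm_le_of_mem_domain (openDomain_subset_domain hz)
        have e2 : (3 : ℝ) ≤ ‖(c : ℂ)‖ ^ 2 := by
          rw [← Complex.normSq_eq_norm_sq, normSq_coe]; exact_mod_cast h
        have e3 : 172 / 100 < ‖(c : ℂ)‖ := by nlinarith [norm_nonneg (c : ℂ)]
        have e4 := norm_sub_norm_le (c : ℂ) z
        rw [norm_sub_rev] at e4
        linarith
      have e1 := far _ hop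
      have e2 := far _ hu.1
      exact ⟨⟨fun _ => by linarith, fun _ => by linarith⟩, fun h => by linarith⟩
  exact ⟨⟨hop, fun c => (main c).2⟩, fun c => (main c).1⟩

lemma one_lt_norm_sub_unit {u : ℂ} (hu : u ≠ 0) (h : u⁻¹ ∈ openDomain) {c : GaussianInt}
    (hc : c.norm = 1) : 1 < ‖u - c‖ := by
  have hb : Complex.normSq (c : ℂ) = 1 := by rw [normSq_coe, hc]; simp
  have h5 := norm_inv_sub_unit (inv_ne_zero hu) hb
  rw [inv_inv] at h5
  have h6 : ((c : ℂ) * u⁻¹).re < 1 / 2 := by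
    obtain ⟨x, y⟩ := c
    have hc' : x * x + y * y = 1 := by simpa [Zsqrtd.norm] using hc
    have hx : -1 ≤ x ∧ x ≤ 1 := ⟨by nlinarith, by nlinarith⟩
    have hy : -1 ≤ y ∧ y ≤ 1 := ⟨by nlinarith, by nlinarith⟩
    obtain ⟨h1, h2⟩ := h
    rw [abs_lt] at h1 h2
    obtain ⟨hx1, hx2⟩ := hx
    obtain ⟨hy1, hy2⟩ := hy
    rw [Complex.mul_re, GaussianInt.re_toComplex, GaussianInt.im_toComplex]
    interval_cases x <;> interval_cases y <;> first | (exfalso; revert hc'; decide) | (push_cast; linarith)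
  by_contra hcon
  push Not at hcon
  rcases hcon.lt_or_eq with h | h
  · linarith [h5.1.1 h]
  · linarith [h5.2.1 h]

lemma abs_re_unit_mul_lt {w : ℂ} (h : w ∈ openDomain) {c : GaussianInt} (hc : c.norm = 1) :
    |((c : ℂ) * w).re| < 1 / 2 := by
  obtain ⟨x, y⟩ := c
  have hc' : x * x + y * y = 1 := by simpa [Zsqrtd.norm] using hc
  have hx : -1 ≤ x ∧ x ≤ 1 := ⟨by nlinarith, by nlinarith⟩
  have hy : -1 ≤ y ∧ y ≤ 1 := ⟨by nlinarith, by nlinarith⟩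
  obtain ⟨h1, h2⟩ := h
  rw [abs_lt] at h1 h2 ⊢
  obtain ⟨hx1, hx2⟩ := hx
  obtain ⟨hy1, hy2⟩ := hy
  rw [Complex.mul_re, GaussianInt.re_toComplex, GaussianInt.im_toComplex]
  interval_cases x <;> interval_cases y <;>
    first | (exfalso; revert hc'; decide) | (push_cast; constructor <;> linarith)

lemma half_lt_int_add {n : ℤ} {t : ℝ} (ht : |t| < 1 / 2) :
    (1 / 2 < (n : ℝ) + t ↔ 1 ≤ n) ∧ (n : ℝ) + t ≠ 1 / 2 := by
  rw [abs_lt] at ht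
  have h1 : 1 ≤ n → 1 / 2 < (n : ℝ) + t := fun h => by
    have : (1 : ℝ) ≤ n := by exact_mod_cast h
    linarith
  have h2 : ¬ 1 ≤ n → (n : ℝ) + t < 1 / 2 := fun h => by
    have : (n : ℝ) ≤ 0 := by exact_mod_cast (by omega : n ≤ 0)
    linarith
  by_cases h : 1 ≤ n
  · exact ⟨⟨fun _ => h, fun _ => h1 h⟩, (h1 h).ne'⟩
  · exact ⟨⟨fun h' => absurd h' (h2 h).not_gt, fun h' => absurd h' h⟩, (h2 h).ne⟩

/-- The cell of `T v` is contained in the image under `T` of the points of the cell of `v` with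
the same first partial quotient. -/
lemma inv_add_mem_cell {v w' : ℂ} (hv : v ∈ generic) (hTv : T v ∈ generic)
    (hw' : w' ∈ cell (T v)) : ((nearest (1 / v) : ℂ) + w')⁻¹ ∈ cell v := by
  set a := nearest (1 / v)
  have hv0 : v ≠ 0 := by
    rintro rfl
    have := hv.2 1
    simp at this
  have hu : v⁻¹ = a + T v := inv_eq_nearest_add_T v
  have hv' : v = (a + T v)⁻¹ := by rw [← hu, inv_inv]
  have hne : (a + T v : ℂ) ≠ 0 := by rw [← hu]; exact inv_ne_zero hv0
  rw [hv'] at hv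
  rw [hv']
  -- Translation by `a` permutes the Gaussian integers, so `a + w'` and `a + T v` lie in the same
  -- unit discs. The half-plane conditions depend on the integer `re (c * a)` alone, since `|re (c *
  -- w)| < 1/2` on the open square.
  have shift : ∀ c : GaussianInt, ∀ z : ℂ, (a + z : ℂ) - c = z - ((c - a : GaussianInt) : ℂ) := by
    intro c z; rw [GaussianInt.toComplex_sub]; ring
  have hside : ∀ c : GaussianInt, (‖(a + w' : ℂ) - c‖ < 1 ↔ ‖(a + T v : ℂ) - c‖ < 1) ∧
      ‖(a + w' : ℂ) - c‖ ≠ 1 := by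
    intro c
    rw [shift, shift]
    exact ⟨hw'.2 _, hw'.1.2 _⟩
  refine inv_mem_cell hv (fun c hc => ?_) (fun c _ => hside c) (fun c hc => ?_)
  · have h1 := one_lt_norm_sub_unit hne hv.1 hc
    have h2 := hside c
    by_contra h3
    have := h2.1.1 (lt_of_le_of_ne (not_lt.1 h3) h2.2)
    linarith
  · obtain ⟨n, hn⟩ : ∃ n : ℤ, ((c : ℂ) * a).re = n :=
      ⟨(c * a).re, by rw [← GaussianInt.toComplex_mul, GaussianInt.intCast_re]⟩
    rw [mul_add, mul_add, Complex.add_re, Complex.add_re, hn]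
    have e1 := half_lt_int_add (n := n) (abs_re_unit_mul_lt hw'.1.1 hc)
    have e2 := half_lt_int_add (n := n) (abs_re_unit_mul_lt hTv.1 hc)
    exact ⟨e1.1.trans e2.1.symm, e1.2⟩

lemma eq_of_norm_eq_one {c : GaussianInt} (hc : c.norm = 1) :
    c = ⟨1, 0⟩ ∨ c = ⟨-1, 0⟩ ∨ c = ⟨0, 1⟩ ∨ c = ⟨0, -1⟩ := by
  obtain ⟨x, y⟩ := c
  have hc' : x * x + y * y = 1 := by simpa [Zsqrtd.norm] using hc
  obtain ⟨hx1, hx2⟩ : -1 ≤ x ∧ x ≤ 1 := ⟨by nlinarith, by nlinarith⟩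
  obtain ⟨hy1, hy2⟩ : -1 ≤ y ∧ y ≤ 1 := ⟨by nlinarith, by nlinarith⟩
  interval_cases x <;> interval_cases y <;> revert hc' <;> decide

lemma eq_of_norm_eq_two {c : GaussianInt} (hc : c.norm = 2) :
    c = ⟨1, 1⟩ ∨ c = ⟨1, -1⟩ ∨ c = ⟨-1, 1⟩ ∨ c = ⟨-1, -1⟩ := by
  obtain ⟨x, y⟩ := c
  have hc' : x * x + y * y = 2 := by simpa [Zsqrtd.norm] using hc
  obtain ⟨hx1, hx2⟩ : -1 ≤ x ∧ x ≤ 1 := ⟨by nlinarith, by nlinarith⟩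
  obtain ⟨hy1, hy2⟩ : -1 ≤ y ∧ y ≤ 1 := ⟨by nlinarith, by nlinarith⟩
  interval_cases x <;> interval_cases y <;> revert hc' <;> decide

lemma norm_coe_of_norm_eq {c : GaussianInt} {n : ℤ} (hc : c.norm = n) :
    ‖(c : ℂ)‖ ^ 2 = n := by
  rw [← Complex.normSq_eq_norm_sq, normSq_coe, hc]

lemma generic_ne_zero {w : ℂ} (hw : w ∈ generic) : w ≠ 0 := by
  rintro rfl
  have := hw.2 1
  simp at this

/-- The sign of a real number, where `(-1/2, 1/2)` counts as zero. -/
def coarseSign (X : ℝ) : ℤ := if 1 / 2 < X then 1 else if X < -(1 / 2) then -1 else 0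

lemma coarseSign_spec (X : ℝ) {t : ℝ} (ht : |t| < 1 / 2) :
    ((1 / 2 < 4 * (coarseSign X : ℝ) + t ↔ 1 / 2 < X) ∧ 4 * (coarseSign X : ℝ) + t ≠ 1 / 2) ∧
    ((1 / 2 < -(4 * (coarseSign X : ℝ) + t) ↔ 1 / 2 < -X) ∧
      -(4 * (coarseSign X : ℝ) + t) ≠ 1 / 2) := by
  rw [abs_lt] at ht
  unfold coarseSign
  split_ifs with h1 h2
  · push_cast
    refine ⟨⟨⟨fun _ => h1, fun _ => by linarith⟩, by linarith⟩,
      ⟨⟨fun _ => by linarith, fun _ => by linarith⟩, by linarith⟩⟩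
  · push_cast
    refine ⟨⟨⟨fun _ => by linarith, fun _ => by linarith⟩, by linarith⟩,
      ⟨⟨fun _ => by linarith, fun _ => by linarith⟩, by linarith⟩⟩
  · push_cast
    refine ⟨⟨⟨fun _ => by linarith, fun _ => by linarith⟩, by linarith⟩,
      ⟨⟨fun _ => by linarith, fun _ => by linarith⟩, by linarith⟩⟩

lemma coarseSign_eq_zero {X : ℝ} (h : coarseSign X = 0) : |X| ≤ 1 / 2 := by
  unfold coarseSign at h
  split_ifs at h with h1 h2
  · exact absurd h (by decide)
  · exact abs_le.2 ⟨by linarith, by linarith⟩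

lemma coarseSign_abs (X : ℝ) : ((coarseSign X : ℝ)) ^ 2 ≤ 1 := by
  unfold coarseSign
  split_ifs <;> norm_num

/-- Outside of the corners of the fundamental domain, each cell contains a full cylinder. -/
lemma exists_full_digit {w : ℂ} (hw : w ∈ generic)
    (hcor : ∀ c : GaussianInt, c.norm = 2 → ¬ ‖w - c‖ < 1) :
    ∃ a : GaussianInt, ‖(a : ℂ)‖ ≤ 6 ∧
      ∀ w' ∈ openDomain, ((a : ℂ) + w')⁻¹ ∈ cell w := by
  have hw0 := generic_ne_zero hw
  set u := w⁻¹ with hu_def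
  have hu0 : u ≠ 0 := inv_ne_zero hw0
  have hwu : w = u⁻¹ := by rw [hu_def, inv_inv]
  -- `|w|² ≤ 1/2` forces `|u|² ≥ 2`, so `u` is outside the central square.
  have hnz : coarseSign u.re ≠ 0 ∨ coarseSign u.im ≠ 0 := by
    by_contra hcon
    push Not at hcon
    have e1 := coarseSign_eq_zero hcon.1
    have e2 := coarseSign_eq_zero hcon.2
    rw [abs_le] at e1 e2
    have e3 : Complex.normSq u ≤ 1 / 2 := by rw [Complex.normSq_apply]; nlinarith
    have e4 := normSq_le_of_mem_domain (openDomain_subset_domain hw.1)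
    have e5 : Complex.normSq u * Complex.normSq w = 1 := by
      rw [← map_mul, hu_def, inv_mul_cancel₀ hw0, map_one]
    nlinarith [Complex.normSq_nonneg u, Complex.normSq_nonneg w]
  -- The signs reproduce the half-plane tests satisfied by `u`. The factor 4 moves `a + w'` out of
  -- all unit discs with center of norm at most 2; as `w` is in no corner disc, this agrees with
  -- `u`.
  set a : GaussianInt := ⟨4 * coarseSign u.re, 4 * coarseSign u.im⟩ with ha
  have ha1 : ‖(a : ℂ)‖ ^ 2 = 16 * ((coarseSign u.re : ℝ) ^ 2 + (coarseSign u.im : ℝ) ^ 2) := by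
    rw [← Complex.normSq_eq_norm_sq, Complex.normSq_apply, ha, GaussianInt.re_toComplex,
      GaussianInt.im_toComplex]
    push_cast; ring
  have ha4 : 4 ≤ ‖(a : ℂ)‖ := by
    have hsq : ∀ n : ℤ, n ≠ 0 → (1 : ℝ) ≤ (n : ℝ) ^ 2 := by
      intro n hn
      exact_mod_cast Int.one_le_abs (pow_ne_zero 2 hn) |>.trans_eq (abs_of_nonneg (sq_nonneg n))
    have : (1 : ℝ) ≤ (coarseSign u.re : ℝ) ^ 2 + (coarseSign u.im : ℝ) ^ 2 := by
      rcases hnz with h | h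
      · have := hsq _ h; nlinarith [sq_nonneg (coarseSign u.im : ℝ)]
      · have := hsq _ h; nlinarith [sq_nonneg (coarseSign u.re : ℝ)]
    nlinarith [norm_nonneg (a : ℂ)]
  refine ⟨a, ?_, fun w' hw' => ?_⟩
  · nlinarith [norm_nonneg (a : ℂ), coarseSign_abs u.re, coarseSign_abs u.im]
  have far : ∀ c : GaussianInt, ‖(c : ℂ)‖ ^ 2 ≤ 2 → 1 < ‖(a + w' : ℂ) - c‖ := by
    intro c hc
    have e1 := norm_le_of_mem_domain (openDomain_subset_domain hw')
    have e2 : ‖(c : ℂ)‖ < 15 / 10 := by nlinarith [norm_nonneg (c : ℂ)]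
    have e3 : ‖(a : ℂ)‖ ≤ ‖(a + w' : ℂ) - c‖ + ‖w'‖ + ‖(c : ℂ)‖ := by
      calc ‖(a : ℂ)‖ = ‖((a + w' : ℂ) - c) - w' + c‖ := by congr 1; ring
        _ ≤ _ := (norm_add_le _ _).trans (by gcongr; exact norm_sub_le _ _)
    linarith
  rw [hwu]
  refine inv_mem_cell (by rwa [← hwu]) (fun c hc => ?_) (fun c hc => ?_) (fun c hc => ?_)
  · exact far c (by rw [norm_coe_of_norm_eq hc]; norm_num)
  · have h1 := far c (by rw [norm_coe_of_norm_eq hc]; norm_num)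
    have hb : Complex.normSq (star (c : ℂ)) = 2 := by
      have : star (c : ℂ) = ((star c : GaussianInt) : ℂ) := (GaussianInt.toComplex_star c).symm
      rw [this, normSq_coe, Zsqrtd.norm_conj, hc]
      norm_num
    have h2 := (norm_inv_sub_corner hu0 hb).1
    rw [star_star, ← hwu] at h2
    have h3 := hcor (star c) (by rw [Zsqrtd.norm_conj, hc])
    rw [GaussianInt.toComplex_star] at h3
    have h4 : ¬ ‖u - c‖ < 1 := fun h => h3 (h2.2 h)
    exact ⟨⟨fun h => by linarith, fun h => absurd h h4⟩, by linarith⟩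
  · have e1 := coarseSign_spec u.re hw'.1
    have e2 := coarseSign_spec u.im hw'.2
    have hre : ((a : ℂ) + w').re = 4 * (coarseSign u.re : ℝ) + w'.re := by
      rw [Complex.add_re, ha, GaussianInt.re_toComplex]; push_cast; ring
    have him : ((a : ℂ) + w').im = 4 * (coarseSign u.im : ℝ) + w'.im := by
      rw [Complex.add_im, ha, GaussianInt.im_toComplex]; push_cast; ring
    rcases eq_of_norm_eq_one hc with rfl | rfl | rfl | rfl <;>
      simp only [Complex.mul_re, GaussianInt.re_toComplex, GaussianInt.im_toComplex, Int.cast_one,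
        Int.cast_zero, Int.cast_neg, one_mul, zero_mul, sub_zero, zero_sub, neg_mul, neg_neg,
        hre, him]
    · exact e1.1
    · exact e1.2
    · exact e2.2
    · exact e2.1

lemma inv_full_corner_openDomain {c : GaussianInt} (hc : c.norm = 2) {w' : ℂ}
    (hw' : w' ∈ openDomain) : ((4 * c : GaussianInt) + w' : ℂ)⁻¹ ∈ openDomain := by
  have e1 := norm_le_of_mem_domain (openDomain_subset_domain hw')
  have e2 := norm_coe_of_norm_eq hc
  have e3 : 14 / 10 ≤ ‖(c : ℂ)‖ := by push_cast at e2; nlinarith [norm_nonneg (c : ℂ)]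
  have e4 : 4 * ‖(c : ℂ)‖ ≤ ‖((4 * c : GaussianInt) + w' : ℂ)‖ + ‖w'‖ := by
    calc 4 * ‖(c : ℂ)‖ = ‖(((4 * c : GaussianInt) + w' : ℂ)) - w'‖ := by
          rw [add_sub_cancel_right, GaussianInt.toComplex_mul, norm_mul]
          congr 1
          simp [GaussianInt.toComplex]
      _ ≤ _ := norm_sub_le _ _
  have e5 : ‖((4 * c : GaussianInt) + w' : ℂ)⁻¹‖ < 1 / 2 := by
    rw [norm_inv, inv_lt_comm₀ (by linarith) (by norm_num)]
    linarith
  exact ⟨(Complex.abs_re_le_norm _).trans_lt e5, (Complex.abs_im_le_norm _).trans_lt e5⟩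

/-- A cell in a corner of the fundamental domain contains a full cylinder of order two. -/
lemma corner_full {w : ℂ} (hw : w ∈ generic) {c : GaussianInt} (hc : c.norm = 2)
    (hwc : ‖w - c‖ < 1) {w' : ℂ} (hw' : w' ∈ openDomain) :
    (((star c : GaussianInt) : ℂ) + ((4 * c : GaussianInt) + w' : ℂ)⁻¹)⁻¹ ∈ cell w := by
  have hw0 := generic_ne_zero hw
  set u := w⁻¹ with hu_def
  have hu0 : u ≠ 0 := inv_ne_zero hw0
  have hwu : w = u⁻¹ := by rw [hu_def, inv_inv]
  have hv := inv_full_corner_openDomain hc hw'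
  set v := ((4 * c : GaussianInt) + w' : ℂ)⁻¹ with hv_def
  have hfar := fun {e : GaussianInt} (he : e.norm = 1) =>
    one_lt_norm_sub_unit hu0 (by rw [← hwu]; exact hw.1) he
  have hvn := norm_le_of_mem_domain (openDomain_subset_domain hv)
  -- A corner cell inverts into the unit disc about `star c`, which is why `star c` serves as the
  -- first digit.
  have hucd : ‖u - ((star c : GaussianInt) : ℂ)‖ < 1 := by
    have hb : Complex.normSq (c : ℂ) = 2 := by rw [normSq_coe, hc]; simp
    rw [GaussianInt.toComplex_star]
    exact (norm_inv_sub_corner hu0 hb).1.1 (by rwa [← hwu])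
  -- Avoiding the unit disc about a unit is, after inversion, a half-plane condition on `4 * c +
  -- w'`. The second digit `4 * c` points in a direction that satisfies it for the differences `e -
  -- star c` of norm 1.
  have hvunit : ∀ e : GaussianInt, e.norm = 1 → ((e : ℂ) * ((4 * c : GaussianInt) + w')).re < 1 / 2 →
      1 < ‖v - e‖ := by
    intro e he h
    have hne : ((4 * c : GaussianInt) + w' : ℂ) ≠ 0 := by
      intro h0
      rw [h0, inv_zero] at hv_def
      have e1 := norm_le_of_mem_domain (openDomain_subset_domain hw')
      have e2 := norm_coe_of_norm_eq hc
      have e3 : 14 / 10 ≤ ‖(c : ℂ)‖ := by push_cast at e2; nlinarith [norm_nonneg (c : ℂ)]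
      have e4 : w' = -(4 * c : ℂ) := by
        rw [GaussianInt.toComplex_mul] at h0
        have : ((4 : GaussianInt) : ℂ) = 4 := by simp [GaussianInt.toComplex]
        rw [this] at h0
        linear_combination h0
      rw [e4, norm_neg, norm_mul] at e1
      norm_num at e1
      linarith
    have hb : Complex.normSq (e : ℂ) = 1 := by rw [normSq_coe, he]; simp
    have := norm_inv_sub_unit hne hb
    by_contra hcon
    rcases (not_lt.1 hcon).lt_or_eq with h1 | h1
    · linarith [this.1.1 h1]
    · linarith [this.2.1 h1]
  have hfourre : ((4 : GaussianInt)).re = 4 := rfl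
  have hfourim : ((4 : GaussianInt)).im = 0 := rfl
  have hw1 := abs_lt.1 hw'.1
  have hw2 := abs_lt.1 hw'.2
  have hv1 := abs_lt.1 hv.1
  have hv2 := abs_lt.1 hv.2
  rw [hwu]
  refine inv_mem_cell (by rwa [← hwu]) (fun e he => ?_) (fun e he => ?_) (fun e he => ?_)
  · have hsplit : ((star c : GaussianInt) + v : ℂ) - e = v - ((e - star c : GaussianInt) : ℂ) := by
      rw [GaussianInt.toComplex_sub]; ring
    rw [hsplit]
    by_cases hn : (e - star c).norm = 1
    · apply hvunit _ hn
      rcases eq_of_norm_eq_two hc with rfl | rfl | rfl | rfl <;>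
        rcases eq_of_norm_eq_one he with rfl | rfl | rfl | rfl <;>
        first
        | (exfalso; revert hn; decide)
        | (simp [GaussianInt.toComplex]; linarith)
    · have h5 : (e - star c).norm = 5 := by
        rcases eq_of_norm_eq_two hc with rfl | rfl | rfl | rfl <;>
        rcases eq_of_norm_eq_one he with rfl | rfl | rfl | rfl <;>
        revert hn <;> decide
      have h6 := norm_coe_of_norm_eq h5
      push_cast at h6
      have h7 : 2 < ‖((e - star c : GaussianInt) : ℂ)‖ := by
        nlinarith [norm_nonneg ((e - star c : GaussianInt) : ℂ)]
      have h8 := norm_sub_norm_le ((e - star c : GaussianInt) : ℂ) v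
      rw [norm_sub_rev] at h8
      linarith
  · by_cases hec : e = star c
    · subst hec
      rw [add_sub_cancel_left]
      exact ⟨⟨fun _ => hucd, fun _ => by linarith⟩, by linarith⟩
    · have h5 : 4 ≤ (e - star c).norm := by
        rcases eq_of_norm_eq_two hc with rfl | rfl | rfl | rfl <;>
        rcases eq_of_norm_eq_two he with rfl | rfl | rfl | rfl <;>
        revert hec <;> decide
      have h6 := norm_coe_of_norm_eq (c := e - star c) rfl
      have h6' : (4 : ℝ) ≤ ((e - star c).norm : ℝ) := by exact_mod_cast h5
      have h7 : 2 ≤ ‖((e - star c : GaussianInt) : ℂ)‖ := by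
        nlinarith [norm_nonneg ((e - star c : GaussianInt) : ℂ)]
      have hsplit : ((star c : GaussianInt) + v : ℂ) - e =
          v - ((e - star c : GaussianInt) : ℂ) := by
        rw [GaussianInt.toComplex_sub]; ring
      have hsplit' : u - e = (u - (star c : GaussianInt)) - ((e - star c : GaussianInt) : ℂ) := by
        rw [GaussianInt.toComplex_sub]; ring
      have h8 := norm_sub_norm_le ((e - star c : GaussianInt) : ℂ) v
      rw [norm_sub_rev, ← hsplit] at h8
      have h9 := norm_sub_norm_le ((e - star c : GaussianInt) : ℂ) (u - (star c : GaussianInt))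
      rw [norm_sub_rev ((e - star c : GaussianInt) : ℂ), ← hsplit'] at h9
      exact ⟨⟨fun h => by linarith, fun h => by linarith⟩, by linarith⟩
  -- Differences of the squared inequalities, outside the discs about the units and inside the disc
  -- about `star c`, are linear and decide on which side of each line `u` lies.
  · have hsq : ∀ z : ℂ, 1 < ‖z‖ → 1 < z.re * z.re + z.im * z.im := by
      intro z hz
      rw [← Complex.normSq_apply, Complex.normSq_eq_norm_sq]; nlinarith
    have hsq' : ∀ z : ℂ, ‖z‖ < 1 → z.re * z.re + z.im * z.im < 1 := by
      intro z hz
      rwa [← Complex.normSq_apply, ← norm_lt_one_iff_normSq]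
    have f1 := hsq _ (hfar (e := ⟨1, 0⟩) (by decide))
    have f2 := hsq _ (hfar (e := ⟨-1, 0⟩) (by decide))
    have f3 := hsq _ (hfar (e := ⟨0, 1⟩) (by decide))
    have f4 := hsq _ (hfar (e := ⟨0, -1⟩) (by decide))
    have f5 := hsq' _ hucd
    simp only [Complex.sub_re, Complex.sub_im, GaussianInt.re_toComplex,
      GaussianInt.im_toComplex] at f1 f2 f3 f4
    clear hsq hsq' hfar hvunit hucd hfourre hfourim
    rcases eq_of_norm_eq_two hc with rfl | rfl | rfl | rfl <;>
      simp [GaussianInt.toComplex] at f1 f2 f3 f4 f5 <;>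
      rcases eq_of_norm_eq_one he with rfl | rfl | rfl | rfl <;>
      simp [GaussianInt.toComplex] <;>
      refine ⟨⟨fun _ => by linarith, fun _ => by linarith⟩, fun _ => by linarith⟩

/-! ### Inverse branches of the iterates of the Hurwitz map -/

/-- `w ↦ (p + w p') / (q + w q')` is a right inverse of `T^k` on `A`, with bounded distortion. -/
structure IsChart (p q p' q' : GaussianInt) (k : ℕ) (A : Set ℂ) : Prop where
  det : ‖(p : ℂ) * q' - p' * q‖ = 1
  ne : ∀ w ∈ A, (q : ℂ) + w * q' ≠ 0
  bound : ∀ w ∈ A, ‖(q' : ℂ)‖ ≤ 3 / 2 * ‖(q : ℂ) + w * q'‖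
  iter : ∀ w ∈ A, T^[k] (((p : ℂ) + w * p') / ((q : ℂ) + w * q')) = w
  mem : ∀ w ∈ A, ((p : ℂ) + w * p') / ((q : ℂ) + w * q') ∈ openDomain
  iter_ne : ∀ w ∈ A, ∀ j < k, T^[j] (((p : ℂ) + w * p') / ((q : ℂ) + w * q')) ≠ 0

/-- The unprimed pair is the current convergent and the primed pair the previous one, so the start
is the identity `(0 + w * 1) / (1 + w * 0)`. -/
lemma isChart_zero {A : Set ℂ} (hA : A ⊆ openDomain) : IsChart 0 1 1 0 0 A where
  det := by simp
  ne := by simp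
  bound := fun _ _ => by norm_num
  iter := by simp
  mem := fun w hw => by simpa using hA hw
  iter_ne := by simp

lemma append_denom (q q' a w : ℂ) (h : a + w ≠ 0) :
    (q * a + q') + w * q = (q + (a + w)⁻¹ * q') * (a + w) := by
  field_simp; ring

lemma append_value (p q p' q' a w : ℂ) (h : a + w ≠ 0) :
    ((p * a + p') + w * p) / ((q * a + q') + w * q) =
      (p + (a + w)⁻¹ * p') / (q + (a + w)⁻¹ * q') := by
  rw [append_denom _ _ _ _ h, append_denom _ _ _ _ h, mul_div_mul_right _ _ h]

/-- This is the recurrence of the convergents for one more digit. The constant `3/2` in `bound` is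
reproduced because `|v| (1 + 3/2 |v|) ≤ 3/2` whenever `|v|² ≤ 1/2`. -/
lemma IsChart.append {p q p' q' : GaussianInt} {k : ℕ} {A A' : Set ℂ}
    (h : IsChart p q p' q' k A) (hA : A ⊆ domain) (hA' : A' ⊆ domain) (a : GaussianInt)
    (ha : ∀ w ∈ A', (a : ℂ) + w ≠ 0 ∧ ((a : ℂ) + w)⁻¹ ∈ A) :
    IsChart (p * a + p') (q * a + q') p q (k + 1) A' where
  det := by
    rw [← h.det, ← norm_neg]
    congr 1
    simp only [GaussianInt.toComplex_add, GaussianInt.toComplex_mul]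
    ring
  ne := by
    intro w hw
    simp only [GaussianInt.toComplex_add, GaussianInt.toComplex_mul]
    rw [append_denom _ _ _ _ (ha w hw).1]
    exact mul_ne_zero (h.ne _ (ha w hw).2) (ha w hw).1
  bound := by
    intro w hw
    simp only [GaussianInt.toComplex_add, GaussianInt.toComplex_mul]
    obtain ⟨h0, h1⟩ := ha w hw
    rw [append_denom _ _ _ _ h0]
    set v := ((a : ℂ) + w)⁻¹ with hv
    have e1 : ‖(q : ℂ)‖ ≤ ‖(q : ℂ) + v * q'‖ + ‖v‖ * ‖(q' : ℂ)‖ := by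
      calc ‖(q : ℂ)‖ = ‖((q : ℂ) + v * q') - v * q'‖ := by congr 1; ring
        _ ≤ _ := (norm_sub_le _ _).trans_eq (by rw [norm_mul])
    have e2 := h.bound v h1
    have e3' := two_mul_norm_sq_le (hA h1)
    have e4 : ‖v‖ * ‖(a : ℂ) + w‖ = 1 := by
      rw [← norm_mul, hv, inv_mul_cancel₀ h0, norm_one]
    rw [norm_mul]
    set X := ‖(q : ℂ) + v * q'‖
    have hv0 : 0 ≤ ‖v‖ := norm_nonneg _
    have e5 : ‖(q : ℂ)‖ ≤ X * (1 + 3 / 2 * ‖v‖) := by nlinarith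
    have e6 : X = X * ‖(a : ℂ) + w‖ * ‖v‖ := by rw [mul_assoc, mul_comm _ ‖v‖, e4, mul_one]
    have hY : 0 ≤ X * ‖(a : ℂ) + w‖ := by positivity
    set Y := X * ‖(a : ℂ) + w‖
    rw [e6] at e5
    have : ‖v‖ * (1 + 3 / 2 * ‖v‖) ≤ 3 / 2 := by nlinarith
    nlinarith
  iter := by
    intro w hw
    simp only [GaussianInt.toComplex_add, GaussianInt.toComplex_mul]
    obtain ⟨h0, h1⟩ := ha w hw
    rw [append_value _ _ _ _ _ _ h0, Function.iterate_succ_apply', h.iter _ h1]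
    exact T_inv_add (hA' hw)
  mem := by
    intro w hw
    simp only [GaussianInt.toComplex_add, GaussianInt.toComplex_mul]
    obtain ⟨h0, h1⟩ := ha w hw
    rw [append_value _ _ _ _ _ _ h0]
    exact h.mem _ h1
  iter_ne := by
    intro w hw j hj
    simp only [GaussianInt.toComplex_add, GaussianInt.toComplex_mul]
    obtain ⟨h0, h1⟩ := ha w hw
    rw [append_value _ _ _ _ _ _ h0]
    rcases (Nat.lt_succ_iff.1 hj).lt_or_eq with h2 | rfl
    · exact h.iter_ne _ h1 j h2
    · rw [h.iter _ h1]
      exact inv_ne_zero h0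

lemma chart_sub {p q p' q' w v : ℂ} (hw : q + w * q' ≠ 0) (hv : q + v * q' ≠ 0) :
    (p + w * p') / (q + w * q') - (p + v * p') / (q + v * q') =
      -((w - v) * (p * q' - p' * q)) / ((q + w * q') * (q + v * q')) := by
  rw [div_sub_div _ _ hw hv]
  congr 1
  ring

lemma IsChart.norm_sub {p q p' q' : GaussianInt} {k : ℕ} {A : Set ℂ}
    (h : IsChart p q p' q' k A) {w v : ℂ} (hw : w ∈ A) (hv : v ∈ A) :
    ‖((p : ℂ) + w * p') / ((q : ℂ) + w * q') - ((p : ℂ) + v * p') / ((q : ℂ) + v * q')‖ =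
      ‖w - v‖ / (‖(q : ℂ) + w * q'‖ * ‖(q : ℂ) + v * q'‖) := by
  rw [chart_sub (h.ne w hw) (h.ne v hv), norm_div, norm_neg, norm_mul, norm_mul, h.det, mul_one]

lemma norm_sub_le_of_mem_domain {w v : ℂ} (hw : w ∈ domain) (hv : v ∈ domain) :
    ‖w - v‖ ≤ 142 / 100 := by
  have := norm_sub_le w v
  linarith [norm_le_of_mem_domain hw, norm_le_of_mem_domain hv]

/-- The square has diameter at most `1.42`, and `1 + 1.42 * 3/2 < 4`. -/
lemma IsChart.distortion {p q p' q' : GaussianInt} {k : ℕ} {A : Set ℂ}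
    (h : IsChart p q p' q' k A) (hA : A ⊆ domain) {w v : ℂ} (hw : w ∈ A) (hv : v ∈ A) :
    ‖(q : ℂ) + w * q'‖ ≤ 4 * ‖(q : ℂ) + v * q'‖ := by
  have e1 : ‖(q : ℂ) + w * q'‖ ≤ ‖(q : ℂ) + v * q'‖ + ‖w - v‖ * ‖(q' : ℂ)‖ := by
    calc ‖(q : ℂ) + w * q'‖ = ‖((q : ℂ) + v * q') + (w - v) * q'‖ := by congr 1; ring
      _ ≤ _ := (norm_add_le _ _).trans_eq (by rw [norm_mul])
  have e2 := h.bound v hv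
  have e3 := norm_sub_le_of_mem_domain (hA hw) (hA hv)
  nlinarith [norm_nonneg (w - v), norm_nonneg (q' : ℂ)]

/-- The points whose orbit under the Hurwitz map is generic. -/
def regular : Set ℂ := {x | ∀ j, T^[j] x ∈ generic}

/-- The expansion rate `∏_{j < k} |T^j x|⁻¹`, the square root of the derivative of `T^k`. -/
def expansionRate (x : ℂ) : ℕ → ℝ
  | 0 => 1
  | k + 1 => expansionRate x k * ‖T^[k] x‖⁻¹

lemma self_mem_cell {w : ℂ} (hw : w ∈ generic) : w ∈ cell w := ⟨hw, fun _ => Iff.rfl⟩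

lemma cell_subset_domain (w : ℂ) : cell w ⊆ domain := fun _ h => openDomain_subset_domain h.1.1

/-- Each step follows the digit of `x`; the Markov property `inv_add_mem_cell` keeps the domain a
whole cell. Each new digit multiplies the denominator at the orbit point by `1 / T^[k] x`, whence
the product formula. -/
lemma exists_chart {x : ℂ} (hx : x ∈ regular) (k : ℕ) :
    ∃ p q p' q' : GaussianInt, IsChart p q p' q' k (cell (T^[k] x)) ∧
      x = ((p : ℂ) + T^[k] x * p') / ((q : ℂ) + T^[k] x * q') ∧
      ‖(q : ℂ) + T^[k] x * q'‖ = expansionRate x k := by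
  induction k with
  | zero => exact ⟨0, 1, 1, 0, isChart_zero fun w hw => hw.1.1, by simp, by simp [expansionRate]⟩
  | succ k ih =>
    obtain ⟨p, q, p', q', h1, h2, h3⟩ := ih
    have hk := hx k
    have hk' := hx (k + 1)
    rw [Function.iterate_succ_apply'] at hk' ⊢
    set v := T^[k] x
    set a := nearest (1 / v)
    have hinv : ∀ w ∈ cell (T v), ((a : ℂ) + w)⁻¹ ∈ cell v := fun w hw =>
      inv_add_mem_cell hk hk' hw
    have hne : ∀ w ∈ cell (T v), (a : ℂ) + w ≠ 0 := fun w hw h => by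
      have := generic_ne_zero (hinv w hw).1
      rw [h, inv_zero] at this
      exact this rfl
    have hva : (a : ℂ) + T v = v⁻¹ := (inv_eq_nearest_add_T v).symm
    have hne0 : (a : ℂ) + T v ≠ 0 := hne _ (self_mem_cell hk')
    refine ⟨p * a + p', q * a + q', p, q, h1.append (cell_subset_domain _) (cell_subset_domain _) a
      fun w hw => ⟨hne w hw, hinv w hw⟩, ?_, ?_⟩
    · simp only [GaussianInt.toComplex_add, GaussianInt.toComplex_mul]
      rw [append_value _ _ _ _ _ _ hne0, hva, inv_inv]
      exact h2
    · simp only [GaussianInt.toComplex_add, GaussianInt.toComplex_mul]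
      rw [append_denom _ _ _ _ hne0, norm_mul, hva, inv_inv, h3, norm_inv]
      rfl

lemma expansionRate_pos {x : ℂ} (hx : x ∈ regular) (k : ℕ) : 0 < expansionRate x k := by
  induction k with
  | zero => exact one_pos
  | succ k ih => exact mul_pos ih (inv_pos.2 (norm_pos_iff.2 (generic_ne_zero (hx k))))

lemma one_le_norm_of_inv_mem {z : ℂ} (hz : z ≠ 0) (h : z⁻¹ ∈ domain) : 1 ≤ ‖z‖ := by
  have := norm_le_of_mem_domain h
  rw [norm_inv, inv_le_comm₀ (norm_pos_iff.2 hz) (by norm_num)] at this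
  norm_num at this
  linarith

/-- Near a regular point there is a full inverse branch of an iterate of the Hurwitz map. -/
lemma exists_full_chart {x : ℂ} (hx : x ∈ regular) (k : ℕ) :
    ∃ (p q p' q' : GaussianInt) (K : ℕ), IsChart p q p' q' K openDomain ∧ 0 < K ∧
      ∀ w ∈ openDomain, expansionRate x k / 4 ≤ ‖(q : ℂ) + w * q'‖ ∧
        ‖(q : ℂ) + w * q'‖ ≤ 200 * expansionRate x k ∧
        ‖x - ((p : ℂ) + w * p') / ((q : ℂ) + w * q')‖ ≤ 6 / expansionRate x k ^ 2 := by
  obtain ⟨p, q, p', q', h1, h2, h3⟩ := exists_chart hx k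
  have hD := expansionRate_pos hx k
  set D := expansionRate x k
  have hk := hx k
  set v := T^[k] x
  have est : ∀ z ∈ cell v, D / 4 ≤ ‖(q : ℂ) + z * q'‖ ∧ ‖(q : ℂ) + z * q'‖ ≤ 4 * D ∧
      ‖x - ((p : ℂ) + z * p') / ((q : ℂ) + z * q')‖ ≤ 6 / D ^ 2 := by
    intro z hz
    have e1 := h1.distortion (cell_subset_domain _) hz (self_mem_cell hk)
    have e2 := h1.distortion (cell_subset_domain _) (self_mem_cell hk) hz
    rw [h3] at e1 e2
    refine ⟨by linarith, e1, ?_⟩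
    rw [h2, h1.norm_sub (self_mem_cell hk) hz, h3]
    have e3 := norm_sub_le_of_mem_domain (cell_subset_domain _ (self_mem_cell hk))
      (cell_subset_domain _ hz)
    calc ‖v - z‖ / (D * ‖(q : ℂ) + z * q'‖) ≤ (142 / 100) / (D * (D / 4)) := by
          gcongr; linarith
      _ ≤ 6 / D ^ 2 := by
          rw [div_le_div_iff₀ (by positivity) (by positivity)]
          nlinarith [sq_nonneg D]
  have hne : ∀ (b : GaussianInt) (w : ℂ), ((b : ℂ) + w)⁻¹ ∈ cell v → (b : ℂ) + w ≠ 0 := by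
    intro b w hbw h
    have := generic_ne_zero hbw.1
    rw [h, inv_zero] at this
    exact this rfl
  -- The chart so far lives on the cell of `v` only. One further digit, or two in a corner, extends
  -- the domain to the open square and changes denominators by a bounded factor.
  by_cases hcor : ∀ c : GaussianInt, c.norm = 2 → ¬ ‖v - c‖ < 1
  · obtain ⟨a, ha, hfull⟩ := exists_full_digit hk hcor
    refine ⟨p * a + p', q * a + q', p, q, k + 1, h1.append (cell_subset_domain _)
      openDomain_subset_domain a fun w hw => ⟨hne a w (hfull w hw), hfull w hw⟩,
      Nat.succ_pos _, fun w hw => ?_⟩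
    have hz := hfull w hw
    have hn := hne a w hz
    obtain ⟨e1, e2, e3⟩ := est _ hz
    simp only [GaussianInt.toComplex_add, GaussianInt.toComplex_mul]
    rw [append_value _ _ _ _ _ _ hn, append_denom _ _ _ _ hn, norm_mul]
    have e4 := one_le_norm_of_inv_mem hn (cell_subset_domain _ hz)
    have e5 : ‖(a : ℂ) + w‖ ≤ 7 := by
      have := norm_le_of_mem_domain (openDomain_subset_domain hw)
      linarith [norm_add_le (a : ℂ) w]
    refine ⟨?_, ?_, e3⟩
    · nlinarith
    · nlinarith [norm_nonneg ((a : ℂ) + w)]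
  · push Not at hcor
    obtain ⟨c, hc, hvc⟩ := hcor
    set A : Set ℂ := {z | ∃ w ∈ openDomain, z = ((4 * c : GaussianInt) + w : ℂ)⁻¹} with hA_def
    have hAdom : A ⊆ domain := by
      rintro z ⟨w, hw, rfl⟩
      exact openDomain_subset_domain (inv_full_corner_openDomain hc hw)
    have hcn := norm_coe_of_norm_eq hc
    push_cast at hcn
    have hc1 : 14 / 10 ≤ ‖(c : ℂ)‖ := by nlinarith [norm_nonneg (c : ℂ)]
    have hc2 : ‖(c : ℂ)‖ ≤ 3 / 2 := by nlinarith [norm_nonneg (c : ℂ)]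
    have h4c : ‖((4 * c : GaussianInt) : ℂ)‖ = 4 * ‖(c : ℂ)‖ := by
      rw [GaussianInt.toComplex_mul, norm_mul]
      congr 1
      simp [GaussianInt.toComplex]
    have hbd : ∀ w ∈ openDomain, 1 ≤ ‖((4 * c : GaussianInt) + w : ℂ)‖ ∧
        ‖((4 * c : GaussianInt) + w : ℂ)‖ ≤ 7 := by
      intro w hw
      have e1 := norm_le_of_mem_domain (openDomain_subset_domain hw)
      have e2 := norm_add_le ((4 * c : GaussianInt) : ℂ) w
      have e3 := norm_sub_le_norm_add ((4 * c : GaussianInt) : ℂ) w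
      rw [h4c] at e2 e3
      constructor <;> linarith
    have hn2 : ∀ w ∈ openDomain, ((4 * c : GaussianInt) + w : ℂ) ≠ 0 := by
      intro w hw h
      have := (hbd w hw).1
      rw [h, norm_zero] at this
      linarith
    have hA : ∀ z ∈ A, (((star c : GaussianInt) : ℂ) + z)⁻¹ ∈ cell v := by
      rintro z ⟨w, hw, rfl⟩
      exact corner_full hk hc hvc hw
    have hch1 := h1.append (cell_subset_domain _) hAdom (star c)
      fun z hz => ⟨hne _ z (hA z hz), hA z hz⟩
    have hch2 := hch1.append hAdom openDomain_subset_domain (4 * c)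
      fun w hw => ⟨hn2 w hw, ⟨w, hw, rfl⟩⟩
    refine ⟨_, _, _, _, _, hch2, Nat.succ_pos _, fun w hw => ?_⟩
    have hzA : ((4 * c : GaussianInt) + w : ℂ)⁻¹ ∈ A := ⟨w, hw, rfl⟩
    have hz := hA _ hzA
    have hn := hne _ _ hz
    obtain ⟨e1, e2, e3⟩ := est _ hz
    have hw2 := hn2 w hw
    have e7 : ‖((star c : GaussianInt) : ℂ)‖ = ‖(c : ℂ)‖ := by
      rw [GaussianInt.toComplex_star, Complex.norm_conj]
    obtain ⟨e8, e9⟩ := hbd w hw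
    clear hch1 hch2 hbd hn2 hA
    generalize 4 * c = b at *
    generalize star c = b' at *
    simp only [GaussianInt.toComplex_add, GaussianInt.toComplex_mul]
    rw [append_value _ _ _ _ _ _ hw2, append_denom _ _ _ _ hw2, norm_mul,
      append_value _ _ _ _ _ _ hn, append_denom _ _ _ _ hn, norm_mul]
    set z := ((b : GaussianInt) + w : ℂ)⁻¹
    have e4 := one_le_norm_of_inv_mem hn (cell_subset_domain _ hz)
    have e5 : ‖(b' : ℂ) + z‖ ≤ 3 := by
      have e6 := norm_le_of_mem_domain (hAdom hzA)
      linarith [norm_add_le (b' : ℂ) z]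
    refine ⟨?_, ?_, e3⟩
    · calc D / 4 = D / 4 * 1 * 1 := by ring
        _ ≤ _ := by gcongr
    · calc _ ≤ 4 * D * 3 * 7 := by gcongr
        _ ≤ 200 * D := by linarith

/-! ### Rational points on both sides of which the expansions differ -/

lemma inv_add_mem_rationals {z : ℂ} (hz : z ∈ rationals) (a : GaussianInt)
    (h : (a : ℂ) + z ≠ 0) : ((a : ℂ) + z)⁻¹ ∈ rationals := by
  obtain ⟨p, q, hq, rfl⟩ := hz
  have hq' : (q : ℂ) ≠ 0 := by simpa using hq
  have e : (a : ℂ) + p / q = ((a * q + p : GaussianInt) : ℂ) / q := by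
    rw [GaussianInt.toComplex_add, GaussianInt.toComplex_mul]
    field_simp
  rw [e] at h ⊢
  refine ⟨q, a * q + p, ?_, by rw [inv_div]⟩
  rintro h0
  rw [h0] at h
  simp at h

lemma inv_mem_openDomain {u : ℂ} (hu : 2 < ‖u‖) : u⁻¹ ∈ openDomain := by
  have e5 : ‖u⁻¹‖ < 1 / 2 := by
    rw [norm_inv, inv_lt_comm₀ (by linarith) (by norm_num)]
    linarith
  exact ⟨(Complex.abs_re_le_norm _).trans_lt e5, (Complex.abs_im_le_norm _).trans_lt e5⟩

lemma lt_norm_add {a : GaussianInt} {w : ℂ} (hw : w ∈ openDomain) {t : ℝ}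
    (ha : (t + 71 / 100) ^ 2 < a.norm) : t < ‖(a : ℂ) + w‖ := by
  have e1 := norm_le_of_mem_domain (openDomain_subset_domain hw)
  have e2 := norm_coe_of_norm_eq (c := a) rfl
  have e3 : t + 71 / 100 < ‖(a : ℂ)‖ := by
    rw [← e2] at ha
    exact lt_of_pow_lt_pow_left₀ 2 (norm_nonneg _) ha
  have := norm_sub_le_norm_add (a : ℂ) w
  linarith

/-- Rational points of the circular arc of radius `1` around `s + i` with a prescribed number of
interior iterates whose partial quotients are not purely imaginary. -/
lemma exists_arc_rational (m : ℕ) : ∀ s : ℤ, s = 1 ∨ s = -1 →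
    ∃ w : ℂ, w ∈ openDomain ∧ ‖w - ((⟨s, 1⟩ : GaussianInt) : ℂ)‖ = 1 ∧ w ∈ rationals ∧
      (∃ N, T^[N] w = 0) ∧ (∀ j ≤ m, T^[j] w ∈ openDomain ∧ T^[j] w ≠ 0) ∧
      ∀ j < m, (nearest (1 / T^[j] w)).re ≠ 0 := by
  induction m with
  | zero =>
    intro s hs
    have h0 : (0 : ℂ) ∈ openDomain := by constructor <;> norm_num
    have hu : 2 < ‖((⟨2 * s, -1⟩ : GaussianInt) : ℂ)‖ := by
      have := norm_coe_of_norm_eq (c := (⟨2 * s, -1⟩ : GaussianInt)) (n := 5)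
        (by rcases hs with rfl | rfl <;> rfl)
      push_cast at this
      nlinarith [norm_nonneg ((⟨2 * s, -1⟩ : GaussianInt) : ℂ)]
    have hne : ((⟨2 * s, -1⟩ : GaussianInt) : ℂ) ≠ 0 := by
      intro h
      rw [h, norm_zero] at hu
      linarith
    have hmem := inv_mem_openDomain hu
    refine ⟨((⟨2 * s, -1⟩ : GaussianInt) : ℂ)⁻¹, hmem, ?_, ?_, ⟨1, ?_⟩, ?_, by simp⟩
    · have hb : Complex.normSq ((⟨s, 1⟩ : GaussianInt) : ℂ) = 2 := by
        rw [normSq_coe]; rcases hs with rfl | rfl <;> simp [Zsqrtd.norm]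
      rw [(norm_inv_sub_corner hne hb).2, norm_eq_one_iff_normSq]
      rcases hs with rfl | rfl <;> simp [Complex.normSq_apply] <;> norm_num
    · have := inv_add_mem_rationals (z := 0) ⟨0, 1, one_ne_zero, by simp⟩ ⟨2 * s, -1⟩
        (by simpa using hne)
      simpa using this
    · have := T_inv_add (a := ⟨2 * s, -1⟩) (openDomain_subset_domain h0)
      simpa using this
    · intro j hj
      obtain rfl : j = 0 := by omega
      exact ⟨hmem, inv_ne_zero hne⟩
  | succ m ih =>
    intro s hs
    obtain ⟨w, hw, hc, hrat, ⟨N, hN⟩, h1, h2⟩ := ih (-s) (by omega)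
    -- `a + w - (s - i) = w - (-s + i)`, so inversion carries the arc about `-s + i` to the arc
    -- about `s + i`; the centers alternate. The real part `2 * s` is what makes the digit not
    -- purely imaginary.
    set a : GaussianInt := ⟨2 * s, -2⟩ with ha
    have hnorm : a.norm = 8 := by rcases hs with rfl | rfl <;> rfl
    have hu : 2 < ‖(a : ℂ) + w‖ := lt_norm_add hw (by rw [hnorm]; norm_num)
    have hne : (a : ℂ) + w ≠ 0 := by
      intro h
      rw [h, norm_zero] at hu
      linarith
    have hT : T ((a : ℂ) + w)⁻¹ = w := T_inv_add (openDomain_subset_domain hw)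
    have hmem := inv_mem_openDomain hu
    refine ⟨((a : ℂ) + w)⁻¹, hmem, ?_, inv_add_mem_rationals hrat a hne,
      ⟨N + 1, by rw [Function.iterate_succ_apply, hT, hN]⟩, ?_, ?_⟩
    · have hb : Complex.normSq ((⟨s, 1⟩ : GaussianInt) : ℂ) = 2 := by
        rw [normSq_coe]; rcases hs with rfl | rfl <;> simp [Zsqrtd.norm]
      rw [(norm_inv_sub_corner hne hb).2, ← hc]
      congr 1
      have : star ((⟨s, 1⟩ : GaussianInt) : ℂ) = ((⟨s, -1⟩ : GaussianInt) : ℂ) := by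
        apply Complex.ext <;> simp
      rw [this, ha]
      apply Complex.ext <;> simp <;> ring
    · intro j hj
      cases j with
      | zero => exact ⟨hmem, inv_ne_zero hne⟩
      | succ j =>
        rw [Function.iterate_succ_apply, hT]
        exact h1 j (by omega)
    · intro j hj
      cases j with
      | zero =>
        rw [Function.iterate_zero_apply, one_div, inv_inv,
          nearest_add (openDomain_subset_domain hw), ha]
        rcases hs with rfl | rfl <;> decide
      | succ j =>
        rw [Function.iterate_succ_apply, hT]
        exact h2 j (by omega)

/-- Rounding is locally constant away from the edges, so `T` is a fixed Möbius map near `z`. -/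
lemma eventually_nearest_eq {z : ℂ} (hz : z ≠ 0) (hT : T z ∈ openDomain) :
    (∀ᶠ y in 𝓝 z, nearest (1 / y) = nearest (1 / z)) ∧ ContinuousAt T z := by
  have hc : ContinuousAt (fun y : ℂ => 1 / y - (nearest (1 / z) : ℂ)) z :=
    (continuousAt_const.div continuousAt_id hz).sub continuousAt_const
  have h1 : ∀ᶠ y in 𝓝 z, nearest (1 / y) = nearest (1 / z) := by
    filter_upwards [hc.preimage_mem_nhds (isOpen_openDomain.mem_nhds hT)] with y hy
    symm
    rw [eq_nearest_iff]
    exact openDomain_subset_domain hy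
  refine ⟨h1, hc.congr ?_⟩
  filter_upwards [h1] with y hy
  rw [T, hy]

lemma eventually_iterate_nearest_eq {z : ℂ} {M : ℕ}
    (h : ∀ j < M, T^[j] z ≠ 0 ∧ T^[j + 1] z ∈ openDomain) :
    ∀ᶠ y in 𝓝 z, ∀ j < M, nearest (1 / T^[j] y) = nearest (1 / T^[j] z) := by
  have hcont : ∀ j ≤ M, ContinuousAt (T^[j]) z := by
    intro j
    induction j with
    | zero => intro _; exact continuousAt_id
    | succ j ih =>
      intro hj
      rw [Function.iterate_succ']
      have hj' := h j (by omega)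
      rw [Function.iterate_succ_apply'] at hj'
      exact (eventually_nearest_eq hj'.1 hj'.2).2.comp (ih (by omega))
  have : ∀ j ∈ Finset.range M, ∀ᶠ y in 𝓝 z, nearest (1 / T^[j] y) = nearest (1 / T^[j] z) := by
    intro j hj
    rw [Finset.mem_range] at hj
    have hj' := h j hj
    rw [Function.iterate_succ_apply'] at hj'
    exact (hcont j hj.le).eventually (eventually_nearest_eq hj'.1 hj'.2).1
  filter_upwards [(Finset.eventually_all _).2 this] with y hy j hj
  exact hy j (Finset.mem_range.2 hj)

/-- The reflection in the imaginary axis. -/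
def mirror (z : ℂ) : ℂ := -star z

/-- Rounding commutes with the reflection only off the edges, because the square is half-open; hence
the hypothesis on `T z`. -/
lemma mirror_spec {z : ℂ} (hT : T z ∈ openDomain) :
    nearest (1 / mirror z) = -star (nearest (1 / z)) ∧ T (mirror z) = mirror (T z) := by
  have e : 1 / mirror z - ((-star (nearest (1 / z)) : GaussianInt) : ℂ) = mirror (T z) := by
    rw [T, mirror, mirror, GaussianInt.toComplex_neg, GaussianInt.toComplex_star]
    simp
    ring
  have h1 : nearest (1 / mirror z) = -star (nearest (1 / z)) := by
    symm
    rw [eq_nearest_iff, e]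
    apply openDomain_subset_domain
    refine ⟨?_, ?_⟩
    · simpa [mirror] using hT.1
    · simpa [mirror] using hT.2
  exact ⟨h1, by rw [← e, T, h1]⟩

lemma iterate_mirror {z : ℂ} {M : ℕ} (h : ∀ j < M, T^[j + 1] z ∈ openDomain) :
    ∀ j ≤ M, T^[j] (mirror z) = mirror (T^[j] z) := by
  intro j
  induction j with
  | zero => intro _; rfl
  | succ j ih =>
    intro hj
    have := h j (by omega)
    rw [Function.iterate_succ_apply'] at this
    rw [Function.iterate_succ_apply', Function.iterate_succ_apply', ih (by omega),
      (mirror_spec this).2]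

/-- Rational points on the boundary of the fundamental domain, such that the expansions of the
points near the opposite boundary point are different. -/
lemma exists_boundary_rational (m : ℕ) :
    ∃ r : ℂ, r.re = -(1 / 2) ∧ |r.im| < 1 / 2 ∧ r ∈ rationals ∧ (∃ N, T^[N] r = 0) ∧
      (∀ j < m, T^[j] r ≠ 0) ∧
      ∀ᶠ z in 𝓝 (r + 1), ∀ j < m, nearest (1 / T^[j] z) ≠ nearest (1 / T^[j] r) := by
  obtain ⟨w, hw, hc, hrat, ⟨N, hN⟩, h1, h2⟩ := exists_arc_rational m 1 (Or.inl rfl)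
  -- `a + w + 1 = w - (1 + i)` has modulus 1, which by inversion puts `r` on the line `re = -1/2`.
  set a : GaussianInt := ⟨-2, -1⟩ with ha
  have hnorm : a.norm = 5 := rfl
  have hu : 3 / 2 < ‖(a : ℂ) + w‖ := lt_norm_add hw (by rw [hnorm]; norm_num)
  have hne : (a : ℂ) + w ≠ 0 := by
    intro h
    rw [h, norm_zero] at hu
    linarith
  have hT : T ((a : ℂ) + w)⁻¹ = w := T_inv_add (openDomain_subset_domain hw)
  set r := ((a : ℂ) + w)⁻¹ with hr
  have hr0 : r ≠ 0 := inv_ne_zero hne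
  have hre : r.re = -(1 / 2) := by
    have hb : Complex.normSq (-1 : ℂ) = 1 := by simp
    have h3 := norm_inv_sub_unit hr0 hb
    have h4 : ‖r⁻¹ - -1‖ = 1 := by
      rw [hr, inv_inv, ← hc, ha]
      congr 1
      apply Complex.ext <;> simp <;> ring
    have := h3.2.1 h4
    simp only [neg_mul, one_mul, Complex.neg_re] at this
    linarith
  have him : |r.im| < 1 / 2 := by
    have e1 : ‖r‖ < 2 / 3 := by
      rw [hr, norm_inv, inv_lt_comm₀ (by linarith) (by norm_num)]
      linarith
    have e2 : ‖r‖ ^ 2 = r.re * r.re + r.im * r.im := by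
      rw [← Complex.normSq_eq_norm_sq, Complex.normSq_apply]
    rw [hre] at e2
    rw [abs_lt]
    constructor <;> nlinarith [norm_nonneg r]
  have hit : ∀ j ≤ m, T^[j + 1] r ∈ openDomain := by
    intro j hj
    rw [Function.iterate_succ_apply, hT]
    exact (h1 j hj).1
  have hne' : ∀ j ≤ m + 1, T^[j] r ≠ 0 := by
    intro j hj
    cases j with
    | zero => exact hr0
    | succ j =>
      rw [Function.iterate_succ_apply, hT]
      exact (h1 j (by omega)).2
  have hdig : ∀ j ≤ m, (nearest (1 / T^[j] r)).re ≠ 0 := by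
    intro j hj
    cases j with
    | zero =>
      rw [Function.iterate_zero_apply, one_div, hr, inv_inv,
        nearest_add (openDomain_subset_domain hw), ha]
      decide
    | succ j =>
      rw [Function.iterate_succ_apply, hT]
      exact h2 j (by omega)
  -- On the left edge, reflection is translation by 1. Hence the digits near `r + 1` are `-star` of
  -- those of `r`, and equality would make the real part vanish.
  have hmir : mirror r = r + 1 := by
    apply Complex.ext
    · simp [mirror, hre]; norm_num
    · simp [mirror]
  refine ⟨r, hre, him, inv_add_mem_rationals hrat a hne,
    ⟨N + 1, by rw [Function.iterate_succ_apply, hT, hN]⟩, fun j hj => hne' j (by omega), ?_⟩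
  have hmit := iterate_mirror (z := r) (M := m) fun j hj => hit j hj.le
  rw [hmir] at hmit
  have hloc := eventually_iterate_nearest_eq (z := r + 1) (M := m) (by
    intro j hj
    rw [hmit j hj.le, hmit (j + 1) hj]
    refine ⟨?_, ?_, ?_⟩
    · simpa [mirror] using hne' j (by omega)
    · simpa [mirror] using (hit j hj.le).1
    · simpa [mirror] using (hit j hj.le).2)
  filter_upwards [hloc] with z hz j hj heq
  rw [hz j hj, hmit j hj.le] at heq
  have hTj := hit j hj.le
  rw [Function.iterate_succ_apply'] at hTj
  rw [(mirror_spec hTj).1] at heq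
  have := congrArg Zsqrtd.re heq
  simp only [Zsqrtd.re_neg, Zsqrtd.re_star] at this
  exact hdig j hj.le (by omega)

/-- Interior rational points to which balls are tangent on which the expansions are different. -/
lemma exists_tangent_rational (m : ℕ) :
    ∃ R : ℂ, R ∈ openDomain ∧ R ∈ rationals ∧ (∃ N, T^[N] R = 0) ∧ (∀ j < m, T^[j] R ≠ 0) ∧
      ∃ n : ℂ, ‖n‖ = 1 ∧ ∃ δ : ℝ, 0 < δ ∧ δ ≤ 1 ∧ ∀ ρ, 0 < ρ → ρ < δ →
        ∀ w ∈ Metric.ball (R + ρ * n) ρ, w ∈ openDomain ∧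
          ∀ j < m, nearest (1 / T^[j] w) ≠ nearest (1 / T^[j] R) := by
  obtain ⟨r, hre, him, hrat, ⟨N, hN⟩, hnz, hdiff⟩ := exists_boundary_rational m
  have hrd : r ∈ domain := by
    rw [abs_lt] at him
    exact ⟨by rw [hre], by rw [hre]; norm_num, him.1.le, him.2⟩
  have hfive : ((5 : GaussianInt) : ℂ) = 5 := by simp [GaussianInt.toComplex]
  have hfour : ((4 : GaussianInt) : ℂ) = 4 := by simp [GaussianInt.toComplex]
  have hu : 2 < ‖(5 : ℂ) + r‖ := by
    have := norm_sub_le_norm_add (5 : ℂ) r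
    have := norm_le_of_mem_domain hrd
    norm_num at *
    linarith
  have hne : (5 : ℂ) + r ≠ 0 := by
    intro h
    rw [h, norm_zero] at hu
    linarith
  have hmem := inv_mem_openDomain hu
  have hTR : T ((5 : ℂ) + r)⁻¹ = r := by rw [← hfive]; exact T_inv_add hrd
  have hdR : nearest (1 / ((5 : ℂ) + r)⁻¹) = 5 := by
    rw [one_div, inv_inv, ← hfive]; exact nearest_add hrd
  have hRrat : ((5 : ℂ) + r)⁻¹ ∈ rationals := by
    rw [← hfive]; exact inv_add_mem_rationals hrat 5 (by rwa [hfive])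
  set R := ((5 : ℂ) + r)⁻¹ with hR
  have hR0 : R ≠ 0 := inv_ne_zero hne
  have hRinv : R⁻¹ = 5 + r := inv_inv _
  -- The circle `|9w - 1| = 1` is the inverse of the line `re = 9/2`, the border between the digits
  -- 4 and 5. The point `R` is on it, with digit 5 followed by the digits of `r`. Points near `R`
  -- and outside the circle have digit 4, followed by the digits of a point near `r + 1`. The outer
  -- unit normal at `R` is `9 * R - 1`.
  have hnorm : ∀ w : ℂ, w ≠ 0 →
      (‖9 * w - 1‖ ^ 2 - 1) = 9 * ‖w‖ ^ 2 * (9 - 2 * (w⁻¹).re) := by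
    intro w hw
    rw [← Complex.normSq_eq_norm_sq, ← Complex.normSq_eq_norm_sq]
    have hp : Complex.normSq w ≠ 0 := by simpa using hw
    have e : (w⁻¹).re * Complex.normSq w = w.re := by
      rw [Complex.inv_re, div_mul_cancel₀ _ hp]
    have e2 : Complex.normSq (9 * w - 1) = 81 * Complex.normSq w - 18 * w.re + 1 := by
      simp [Complex.normSq_apply]; ring
    rw [e2, ← e]; ring
  have hn1 : ‖9 * R - 1‖ = 1 := by
    have := hnorm R hR0
    rw [hRinv, Complex.add_re, hre] at this
    norm_num at this
    nlinarith [norm_nonneg (9 * R - 1)]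
  have hev : ∀ᶠ w in 𝓝 R, w ∈ openDomain ∧ w ≠ 0 ∧ w⁻¹ - 4 ∈ {z : ℂ | 0 < z.re ∧ |z.im| < 1 / 2} ∧
      ∀ j < m, nearest (1 / T^[j] (w⁻¹ - 4)) ≠ nearest (1 / T^[j] r) := by
    have hc : ContinuousAt (fun w : ℂ => w⁻¹ - 4) R :=
      (continuousAt_inv₀ hR0).sub continuousAt_const
    have hval : R⁻¹ - 4 = r + 1 := by rw [hRinv]; ring
    have hopen : IsOpen {z : ℂ | 0 < z.re ∧ |z.im| < 1 / 2} := by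
      have h1 : IsOpen {z : ℂ | 0 < z.re} := isOpen_lt continuous_const (by fun_prop)
      have h2 : IsOpen {z : ℂ | |z.im| < 1 / 2} := isOpen_lt (by fun_prop) continuous_const
      exact h1.inter h2
    have h3 := hc.preimage_mem_nhds (hopen.mem_nhds (by
      rw [hval]; exact ⟨by simp [hre]; norm_num, by simpa using him⟩))
    have hc' : Tendsto (fun w : ℂ => w⁻¹ - 4) (𝓝 R) (𝓝 (r + 1)) := by
      rw [← hval]; exact hc
    filter_upwards [isOpen_openDomain.mem_nhds hmem, isOpen_ne.mem_nhds hR0, h3,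
      hc'.eventually hdiff] with w e1 e2 e3 e4
    exact ⟨e1, e2, e3, e4⟩
  obtain ⟨ε, hε, hball⟩ := Metric.eventually_nhds_iff.1 hev
  refine ⟨R, hmem, hRrat, ⟨N + 1, by rw [Function.iterate_succ_apply, hTR, hN]⟩, ?_, 9 * R - 1, hn1,
    min (ε / 2) 1, by positivity, min_le_right _ _, ?_⟩
  · intro j hj
    cases j with
    | zero => exact hR0
    | succ j =>
      rw [Function.iterate_succ_apply, hTR]
      exact hnz j (by omega)
  intro ρ hρ hρδ w hw
  rw [Metric.mem_ball, dist_eq_norm] at hw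
  have hρε : ρ < ε / 2 := hρδ.trans_le (min_le_left _ _)
  have hdist : dist w R < ε := by
    rw [dist_eq_norm]
    calc ‖w - R‖ = ‖(w - (R + ρ * (9 * R - 1))) + ρ * (9 * R - 1)‖ := by congr 1; ring
      _ ≤ ‖w - (R + ρ * (9 * R - 1))‖ + ‖(ρ : ℂ) * (9 * R - 1)‖ := norm_add_le _ _
      _ < ρ + ρ := by
        rw [norm_mul, hn1, mul_one, Complex.norm_real, Real.norm_of_nonneg hρ.le]
        linarith
      _ ≤ ε := by linarith
  obtain ⟨e1, e2, e3, e4⟩ := hball hdist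
  have hout : 1 < ‖9 * w - 1‖ := by
    have h1 : ‖(1 + 9 * ρ : ℂ) * (9 * R - 1)‖ = 1 + 9 * ρ := by
      rw [norm_mul, hn1, mul_one]
      have : (1 + 9 * ρ : ℂ) = ((1 + 9 * ρ : ℝ) : ℂ) := by push_cast; ring
      rw [this, Complex.norm_real, Real.norm_of_nonneg (by positivity)]
    have h2 : ‖(1 + 9 * ρ : ℂ) * (9 * R - 1)‖ ≤ ‖9 * w - 1‖ +
        9 * ‖w - (R + ρ * (9 * R - 1))‖ := by
      calc _ = ‖(9 * w - 1) - 9 * (w - (R + ρ * (9 * R - 1)))‖ := by congr 1; ring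
        _ ≤ _ := (norm_sub_le _ _).trans_eq (by rw [norm_mul]; norm_num)
    linarith
  have hrew : (w⁻¹).re < 9 / 2 := by
    have h1 := hnorm w e2
    by_contra hcon
    nlinarith
  have hzd : w⁻¹ - 4 ∈ domain := by
    have h1 := e3.1
    have h2 := abs_lt.1 e3.2
    refine ⟨by linarith, ?_, h2.1.le, h2.2⟩
    simp only [Complex.sub_re, Complex.re_ofNat]
    linarith
  have hw4 : 1 / w = (4 : GaussianInt) + (w⁻¹ - 4) := by rw [hfour, one_div]; ring
  have hnw : nearest (1 / w) = 4 := by rw [hw4]; exact nearest_add hzd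
  have hTw : T w = w⁻¹ - 4 := by rw [T, hnw, hfour, one_div]
  refine ⟨e1, fun j hj => ?_⟩
  cases j with
  | zero =>
    rw [Function.iterate_zero_apply, Function.iterate_zero_apply, hnw, hdR]
    decide
  | succ j =>
    rw [Function.iterate_succ_apply, Function.iterate_succ_apply, hTw, hTR]
    exact e4 j (by omega)

/-- The nonvanishing conditions ensure that the expansion of `P` has at least `K + m` digits. Since
`a_n` is read off from `T^[n - 1]`, the differing places are `K + 1, ..., K + m`. -/
lemma le_diffCount {y P : ℂ} {K m : ℕ} (hK : ∀ j < K, T^[j] P ≠ 0)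
    (hm : ∀ j < m, T^[j] (T^[K] P) ≠ 0) (hN : ∃ N, T^[N] (T^[K] P) = 0)
    (hd : ∀ j < m, nearest (1 / T^[j] (T^[K] y)) ≠ nearest (1 / T^[j] (T^[K] P))) :
    m ≤ diffCount y P := by
  obtain ⟨N, hN⟩ := hN
  have hne : {n : ℕ | T^[n] P = 0}.Nonempty := ⟨N + K, by
    change T^[N + K] P = 0
    rw [Function.iterate_add_apply, hN]⟩
  have hL : T^[expansionLength P] P = 0 := Nat.sInf_mem hne
  have hlen : K + m ≤ expansionLength P := by
    by_contra hcon
    rcases lt_or_ge (expansionLength P) K with h | h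
    · exact hK _ h hL
    · obtain ⟨j, hj⟩ := Nat.exists_eq_add_of_le' h
      rw [hj, Function.iterate_add_apply] at hL
      exact hm j (by omega) hL
  have hfin : {n : ℕ | 1 ≤ n ∧ n ≤ expansionLength P ∧
      partialQuotient y n ≠ partialQuotient P n}.Finite :=
    (Set.finite_Iic (expansionLength P)).subset fun n hn => hn.2.1
  have hsub : Set.Icc (K + 1) (K + m) ⊆ {n : ℕ | 1 ≤ n ∧ n ≤ expansionLength P ∧
      partialQuotient y n ≠ partialQuotient P n} := by
    rintro n ⟨h1, h2⟩
    refine ⟨by omega, by omega, ?_⟩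
    have e : n - 1 = (n - 1 - K) + K := by omega
    rw [partialQuotient, partialQuotient, e, Function.iterate_add_apply,
      Function.iterate_add_apply]
    exact hd _ (by omega)
  have := Set.ncard_le_ncard hsub hfin
  rw [diffCount]
  refine le_trans ?_ this
  rw [← Finset.coe_Icc, Set.ncard_coe_finset, Nat.card_Icc]
  omega

/-- A chart maps a ball onto a set which contains a ball of comparable size. -/
lemma IsChart.exists_preimage {p q p' q' : GaussianInt} {k : ℕ} {A : Set ℂ}
    (h : IsChart p q p' q' k A) {w y : ℂ} (hw : w ∈ A) {ρ : ℝ} (hρ1 : ρ ≤ 1)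
    (hball : Metric.ball w ρ ⊆ A)
    (hy : ‖y - ((p : ℂ) + w * p') / ((q : ℂ) + w * q')‖ * (4 * ‖(q : ℂ) + w * q'‖ ^ 2) ≤ ρ)
    (hρ : 0 < ρ) :
    ∃ v ∈ Metric.ball w ρ, y = ((p : ℂ) + v * p') / ((q : ℂ) + v * q') := by
  have hne := h.ne w hw
  have hbd := h.bound w hw
  set y₀ := ((p : ℂ) + w * p') / ((q : ℂ) + w * q')
  set D := ‖(q : ℂ) + w * q'‖ with hD
  have hDpos : 0 < D := norm_pos_iff.2 hne
  have hy₀' : y₀ * ((q : ℂ) + w * q') = (p : ℂ) + w * p' := div_mul_cancel₀ _ hne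
  have e0 : ((p' : ℂ) - q' * y₀) * ((q : ℂ) + w * q') = -((p : ℂ) * q' - p' * q) := by
    linear_combination (-(q' : ℂ)) * hy₀'
  have e1 : ‖(p' : ℂ) - q' * y₀‖ * D = 1 := by
    rw [hD, ← norm_mul, e0, norm_neg, h.det]
  have e2 : ‖(p' : ℂ) - q' * y₀‖ ≤ ‖(p' : ℂ) - q' * y‖ + ‖(q' : ℂ)‖ * ‖y - y₀‖ := by
    calc _ = ‖((p' : ℂ) - q' * y) + q' * (y - y₀)‖ := by congr 1; ring
      _ ≤ _ := (norm_add_le _ _).trans_eq (by rw [norm_mul])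
  set d := ‖y - y₀‖ with hd
  -- At `y₀` this product is 1. By `bound` and `hy` it changes by at most `3/2 * d * D² ≤ 3/8`, so
  -- the inverse Möbius map has no pole near `y₀`.
  have e3 : 1 / 2 ≤ ‖(p' : ℂ) - q' * y‖ * D := by
    have e4 : ‖(q' : ℂ)‖ * d * D ≤ 3 / 2 * D * d * D := by gcongr
    nlinarith
  have hne' : (p' : ℂ) - q' * y ≠ 0 := by
    intro h0
    rw [h0] at e3
    norm_num at e3
  set v := ((q : ℂ) * y - p) / ((p' : ℂ) - q' * y)
  have hv' : v * ((p' : ℂ) - q' * y) = (q : ℂ) * y - p := div_mul_cancel₀ _ hne'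
  have hsub : (v - w) * ((p' : ℂ) - q' * y) = (y - y₀) * ((q : ℂ) + w * q') := by
    linear_combination hv' + hy₀'
  have e5 : ‖v - w‖ * ‖(p' : ℂ) - q' * y‖ = d * D := by
    rw [← norm_mul, hsub, norm_mul]
  have hvw : ‖v - w‖ < ρ := by
    nlinarith
  have hvb : v ∈ Metric.ball w ρ := by rwa [Metric.mem_ball, dist_eq_norm]
  refine ⟨v, hvb, ?_⟩
  rw [eq_div_iff (h.ne v (hball hvb))]
  linear_combination -hv'

/-- The local approximation statement: near each regular point there are rational points with
controlled denominators, and with nearby balls on which the expansions are different. -/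
lemma exists_good_ball (m : ℕ) {δ : ℝ} (hδ : 0 < δ) :
    ∃ C : ℝ, 1 ≤ C ∧ ∀ x ∈ regular, ∀ Q : ℝ, 0 < Q →
      (∃ k, δ * Q ≤ expansionRate x k ∧ expansionRate x k ≤ Q) →
      ∀ τ : ℝ, 0 < τ → C * (τ * Q ^ 2) ≤ 1 →
      ∃ p q : GaussianInt, q ≠ 0 ∧ (p : ℂ) / q ∈ domainStar ∧ ‖(q : ℂ)‖ ≤ C * Q ∧
        ‖x - (p : ℂ) / q‖ ≤ C / Q ^ 2 ∧
        ∃ z : ℂ, ‖z - (p : ℂ) / q‖ + τ / 512 ≤ τ ∧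
          ∀ y ∈ Metric.closedBall z (τ / 512), y ∈ domainStar ∧ m ≤ diffCount y ((p : ℂ) / q) := by
  obtain ⟨R, hR, ⟨s, t, ht, hst⟩, hN, hnz, n, hn, ε, hε, hε1, hgood⟩ := exists_tangent_rational m
  -- The summands control, in this order, positivity, the denominator of the transported rational,
  -- its distance from `x`, and the requirement `ρ < ε`, where `ρ ≤ 5000 * (τ * Q ^ 2)`.
  refine ⟨1 + 200 * ‖(t : ℂ)‖ + 6 / δ ^ 2 + 5001 / ε, ?_, ?_⟩
  · have : 0 ≤ 200 * ‖(t : ℂ)‖ + 6 / δ ^ 2 + 5001 / ε := by positivity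
    linarith
  intro x hx Q hQ hk τ hτ hτQ
  obtain ⟨k, hk1, hk2⟩ := hk
  set C := 1 + 200 * ‖(t : ℂ)‖ + 6 / δ ^ 2 + 5001 / ε with hC
  have hC1 : 200 * ‖(t : ℂ)‖ ≤ C := by
    have : 0 ≤ 6 / δ ^ 2 + 5001 / ε := by positivity
    linarith
  have hC2 : 6 / δ ^ 2 ≤ C := by
    have : 0 ≤ 200 * ‖(t : ℂ)‖ + 5001 / ε := by positivity
    linarith
  have hC3 : 5001 / ε ≤ C := by
    have : 0 ≤ 200 * ‖(t : ℂ)‖ + 6 / δ ^ 2 := by positivity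
    linarith
  obtain ⟨p, q, p', q', K, hch, hK, hest⟩ := exists_full_chart hx k
  obtain ⟨g1, g2, g3⟩ := hest R hR
  have hDk := expansionRate_pos hx k
  set D := ‖(q : ℂ) + R * q'‖ with hD
  have hRne := hch.ne R hR
  have ht0 : (t : ℂ) ≠ 0 := by simpa using ht
  have hval : ((p : ℂ) + R * p') / ((q : ℂ) + R * q') =
      ((p * t + s * p' : GaussianInt) : ℂ) / ((q * t + s * q' : GaussianInt) : ℂ) := by
    simp only [GaussianInt.toComplex_add, GaussianInt.toComplex_mul]
    rw [← mul_div_mul_right _ _ ht0, hst]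
    congr 1 <;> field_simp
  have hden : ((q * t + s * q' : GaussianInt) : ℂ) = ((q : ℂ) + R * q') * t := by
    simp only [GaussianInt.toComplex_add, GaussianInt.toComplex_mul]
    rw [hst]; field_simp
  have hitR := hch.iter R hR
  refine ⟨p * t + s * p', q * t + s * q', ?_, ?_, ?_, ?_, ?_⟩
  · intro h0
    rw [h0, GaussianInt.toComplex_zero] at hden
    exact mul_ne_zero hRne ht0 hden.symm
  · rw [← hval]
    exact ⟨openDomain_subset_domain (hch.mem R hR), hch.iter_ne R hR 0 hK⟩
  · rw [hden, norm_mul]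
    calc D * ‖(t : ℂ)‖ ≤ 200 * Q * ‖(t : ℂ)‖ := by gcongr; linarith
      _ = 200 * ‖(t : ℂ)‖ * Q := by ring
      _ ≤ C * Q := by gcongr
  · rw [← hval]
    refine g3.trans ?_
    calc 6 / expansionRate x k ^ 2 ≤ 6 / (δ * Q) ^ 2 := by gcongr
      _ = 6 / δ ^ 2 / Q ^ 2 := by rw [mul_pow]; field_simp
      _ ≤ C / Q ^ 2 := by gcongr
  rw [← hval]
  set P := ((p : ℂ) + R * p') / ((q : ℂ) + R * q') with hP
  -- The chart contracts by about `D²`. With the factor 8 and distortion 4, the image center is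
  -- within `τ / 2` of `P`. The radius comes from `512 = 8 * 4 * 4²`: this factor, the 4 of
  -- `exists_preimage`, and the squared distortion.
  set ρ := τ * D ^ 2 / 8 with hρ
  have hρpos : 0 < ρ := by positivity
  have hDQ : D ≤ 200 * Q := by linarith
  have hρε : ρ < ε := by
    have h1 : 5001 / ε * (τ * Q ^ 2) ≤ 1 :=
      (mul_le_mul_of_nonneg_right hC3 (by positivity)).trans hτQ
    have h2 : 5001 * (τ * Q ^ 2) ≤ ε := by
      rw [div_mul_eq_mul_div, div_le_one hε] at h1; exact h1
    have h4 : τ * D ^ 2 ≤ τ * (200 * Q) ^ 2 := by gcongr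
    rw [hρ]
    nlinarith
  set w := R + ρ * n with hw
  have hwb : w ∈ Metric.ball w ρ := Metric.mem_ball_self hρpos
  have hsub : Metric.ball w ρ ⊆ openDomain := fun v hv => (hgood ρ hρpos hρε v hv).1
  have hwO := hsub hwb
  set z := ((p : ℂ) + w * p') / ((q : ℂ) + w * q') with hz
  have hd1 := hch.distortion openDomain_subset_domain hwO hR
  have hd2 := hch.distortion openDomain_subset_domain hR hwO
  set D' := ‖(q : ℂ) + w * q'‖ with hD'
  have hD'pos : 0 < D' := by linarith
  refine ⟨z, ?_, ?_⟩
  · have h1 : ‖z - P‖ ≤ τ / 2 := by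
      rw [hz, hP, hch.norm_sub hwO hR, hw, add_sub_cancel_left, norm_mul, hn, mul_one,
        Complex.norm_real, Real.norm_of_nonneg hρpos.le, ← hw, ← hD', ← hD,
        div_le_iff₀ (by positivity), hρ]
      have : τ / 2 * (D * D) ≤ τ / 2 * (4 * D' * D) := by gcongr
      nlinarith
    linarith
  · intro y hy
    rw [Metric.mem_closedBall, dist_eq_norm] at hy
    have h2 : ‖y - z‖ * (4 * D' ^ 2) ≤ ρ := by
      calc ‖y - z‖ * (4 * D' ^ 2) ≤ τ / 512 * (4 * (4 * D) ^ 2) := by gcongr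
        _ = ρ := by rw [hρ]; ring
    obtain ⟨v, hv, rfl⟩ := hch.exists_preimage hwO (hρε.le.trans hε1) hsub h2 hρpos
    have hvO := hsub hv
    refine ⟨⟨openDomain_subset_domain (hch.mem v hvO), hch.iter_ne v hvO 0 hK⟩, ?_⟩
    refine le_diffCount (K := K) (hch.iter_ne R hR) ?_ ?_ ?_
    · rw [hitR]; exact hnz
    · rw [hitR]; exact hN
    · rw [hitR, hch.iter v hvO]
      exact (hgood ρ hρpos hρε v hv).2

/-! ### Almost every point is regular -/

open MeasureTheory in
lemma volume_inv_preimage_eq_zero {S : Set ℂ} (hS : volume S = 0) :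
    volume {z : ℂ | z⁻¹ ∈ S} = 0 := by
  have h1 : {z : ℂ | z⁻¹ ∈ S} ⊆ {0} ∪ (fun z : ℂ => z⁻¹) '' (S \ {0}) := by
    intro z hz
    by_cases h : z = 0
    · exact Or.inl h
    · exact Or.inr ⟨z⁻¹, ⟨hz, inv_ne_zero h⟩, inv_inv z⟩
  refine measure_mono_null h1 (measure_union_null (measure_singleton 0) ?_)
  refine addHaar_image_eq_zero_of_differentiableOn_of_addHaar_eq_zero volume ?_
    (measure_mono_null Set.sdiff_subset hS)
  intro z hz
  have : DifferentiableAt ℂ (fun z : ℂ => z⁻¹) z := differentiableAt_inv hz.2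
  exact (this.restrictScalars ℝ).differentiableWithinAt

-- `T` consists of countably many translates of inversion, which is smooth off the origin.
open MeasureTheory in
lemma volume_T_preimage_eq_zero {S : Set ℂ} (hS : volume S = 0) :
    volume (T ⁻¹' S) = 0 := by
  have h1 : T ⁻¹' S ⊆ ⋃ a : ℤ × ℤ,
      {z : ℂ | z⁻¹ ∈ (fun u : ℂ => u + -((⟨a.1, a.2⟩ : GaussianInt) : ℂ)) ⁻¹' S} := by
    intro z hz
    rw [Set.mem_iUnion]
    refine ⟨((nearest (1 / z)).re, (nearest (1 / z)).im), ?_⟩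
    change z⁻¹ + -(nearest (1 / z) : ℂ) ∈ S
    rw [← sub_eq_add_neg, ← one_div]
    exact hz
  refine measure_mono_null h1 (measure_iUnion_null fun a => volume_inv_preimage_eq_zero ?_)
  rw [measure_preimage_add_right, hS]

open MeasureTheory in
lemma volume_re_eq_zero (a : ℝ) : volume {z : ℂ | z.re = a} = 0 := by
  have h := Complex.volume_preserving_equiv_real_prod.measure_preimage_equiv
    (({a} : Set ℝ) ×ˢ (Set.univ : Set ℝ))
  rw [Measure.volume_eq_prod, Measure.prod_prod, Real.volume_singleton, zero_mul] at h
  convert h using 2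
  ext z
  simp [Complex.measurableEquivRealProd_apply]

open MeasureTheory in
lemma volume_im_eq_zero (a : ℝ) : volume {z : ℂ | z.im = a} = 0 := by
  have h := Complex.volume_preserving_equiv_real_prod.measure_preimage_equiv
    ((Set.univ : Set ℝ) ×ˢ ({a} : Set ℝ))
  rw [Measure.volume_eq_prod, Measure.prod_prod, Real.volume_singleton, mul_zero] at h
  convert h using 2
  ext z
  simp [Complex.measurableEquivRealProd_apply]

open MeasureTheory in
lemma volume_domain_diff_generic : volume (domain \ generic) = 0 := by
  have h1 : domain \ generic ⊆ {z : ℂ | z.re = -(1 / 2)} ∪ {z : ℂ | z.im = -(1 / 2)} ∪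
      ⋃ a : ℤ × ℤ, Metric.sphere ((⟨a.1, a.2⟩ : GaussianInt) : ℂ) 1 := by
    rintro z ⟨⟨h1, h2, h3, h4⟩, hg⟩
    by_contra hcon
    simp only [Set.mem_union, not_or, Set.mem_iUnion, not_exists, Set.mem_ofPred_eq] at hcon
    obtain ⟨⟨c1, c2⟩, c3⟩ := hcon
    refine hg ⟨⟨?_, ?_⟩, fun c hc => c3 (c.re, c.im) ?_⟩
    · exact abs_lt.2 ⟨lt_of_le_of_ne h1 (Ne.symm c1), h2⟩
    · exact abs_lt.2 ⟨lt_of_le_of_ne h3 (Ne.symm c2), h4⟩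
    · rw [mem_sphere_iff_norm]; exact hc
  refine measure_mono_null h1 (measure_union_null (measure_union_null (volume_re_eq_zero _)
    (volume_im_eq_zero _)) (measure_iUnion_null fun a => ?_))
  exact Measure.addHaar_sphere _ _ _

open MeasureTheory in
lemma volume_domain_diff_regular : volume (domain \ regular) = 0 := by
  have h1 : domain \ regular ⊆ ⋃ j : ℕ, T^[j] ⁻¹' (domain \ generic) := by
    rintro z ⟨hz, hr⟩
    obtain ⟨j, hj⟩ := not_forall.1 hr
    exact Set.mem_iUnion.2 ⟨j, iterate_T_mem_domain hz j, hj⟩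
  refine measure_mono_null h1 (measure_iUnion_null fun j => ?_)
  induction j with
  | zero => exact volume_domain_diff_generic
  | succ j ih =>
    rw [Function.iterate_succ, Set.preimage_comp]
    exact volume_T_preimage_eq_zero ih

/-! ### Few points have an expansion rate that jumps over a long interval -/

lemma pow_le_expansionRate {x : ℂ} (hx : x ∈ regular) (k : ℕ) :
    (7 / 5 : ℝ) ^ k ≤ expansionRate x k := by
  induction k with
  | zero => simp [expansionRate]
  | succ k ih =>
    have h1 := norm_le_of_mem_domain (openDomain_subset_domain (hx k).1)
    have h0 := norm_pos_iff.2 (generic_ne_zero (hx k))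
    have h2 : 7 / 5 ≤ ‖T^[k] x‖⁻¹ := by
      rw [le_inv_comm₀ (by norm_num) h0]; linarith
    rw [pow_succ]
    exact mul_le_mul ih h2 (by norm_num) (expansionRate_pos hx k).le

/-- A jump over `[δ Q, Q]` means that the last rate `D` before exceeding `Q` is below `δ Q`. For the
convergent at that time, `|q x - p|` is `|T^k x| / D`, the reciprocal of the next rate. -/
lemma exists_close_rational {x : ℂ} (hx : x ∈ regular) {Q δ : ℝ} (hQ : 1 ≤ Q)
    (hδ1 : δ ≤ 1 / 2) (h : ¬ ∃ k, δ * Q ≤ expansionRate x k ∧ expansionRate x k ≤ Q) :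
    ∃ p q : GaussianInt, q ≠ 0 ∧ ‖(q : ℂ)‖ ≤ 2 * δ * Q ∧ ‖(q : ℂ) * x - p‖ ≤ 1 / Q := by
  classical
  have hex : ∃ k, Q < expansionRate x k := by
    obtain ⟨k, hk⟩ := pow_unbounded_of_one_lt Q (by norm_num : (1 : ℝ) < 7 / 5)
    exact ⟨k, hk.trans_le (pow_le_expansionRate hx k)⟩
  obtain ⟨k, hk⟩ : ∃ k, Nat.find hex = k + 1 := by
    refine Nat.exists_eq_succ_of_ne_zero fun h0 => ?_
    have := Nat.find_spec hex
    rw [h0] at this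
    simp only [expansionRate] at this
    linarith
  have h1 : Q < expansionRate x (k + 1) := by rw [← hk]; exact Nat.find_spec hex
  have h2 : expansionRate x k ≤ Q := not_lt.1 (Nat.find_min hex (by omega))
  have h3 : expansionRate x k < δ * Q := by
    by_contra hcon
    exact h ⟨k, not_lt.1 hcon, h2⟩
  obtain ⟨p, q, p', q', hch, hxeq, hD⟩ := exists_chart hx k
  have hDpos := expansionRate_pos hx k
  have hw0 := norm_pos_iff.2 (generic_ne_zero (hx k))
  have hself := self_mem_cell (hx k)
  have hne := hch.ne _ hself
  have hbd := hch.bound _ hself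
  rw [expansionRate] at h1
  set w := T^[k] x
  set D := expansionRate x k
  rw [hD] at hbd
  have hDw : Q * ‖w‖ < D := by
    rw [← div_eq_mul_inv, lt_div_iff₀ hw0] at h1
    exact h1
  have hwδ : ‖w‖ < δ := by nlinarith
  have hx' : x * ((q : ℂ) + w * q') = (p : ℂ) + w * p' := by
    conv_lhs => rw [hxeq]
    exact div_mul_cancel₀ _ hne
  have hwq : ‖w * (q' : ℂ)‖ ≤ 3 / 4 * D := by
    rw [norm_mul]
    calc ‖w‖ * ‖(q' : ℂ)‖ ≤ (1 / 2) * (3 / 2 * D) := by gcongr; linarith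
      _ = _ := by ring
  refine ⟨p, q, ?_, ?_, ?_⟩
  · rintro rfl
    rw [GaussianInt.toComplex_zero, zero_add] at hD
    linarith
  · have : ‖(q : ℂ)‖ ≤ ‖(q : ℂ) + w * q'‖ + ‖w * (q' : ℂ)‖ := by
      calc ‖(q : ℂ)‖ = ‖((q : ℂ) + w * q') - w * q'‖ := by congr 1; ring
        _ ≤ _ := norm_sub_le _ _
    rw [hD] at this
    linarith
  · have e1 : ((q : ℂ) * x - p) * ((q : ℂ) + w * q') = -(w * ((p : ℂ) * q' - p' * q)) := by
      linear_combination (q : ℂ) * hx'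
    have e2 : ‖(q : ℂ) * x - p‖ * D = ‖w‖ := by
      rw [← hD, ← norm_mul, e1, norm_neg, norm_mul, hch.det, mul_one]
    rw [le_div_iff₀ (by linarith)]
    by_contra hcon
    push Not at hcon
    have : D < ‖(q : ℂ) * x - p‖ * Q * D := by nlinarith
    nlinarith

lemma exists_finset_gaussianInt (z : ℂ) {r : ℝ} (hr : 0 ≤ r) :
    ∃ F : Finset GaussianInt, (∀ p : GaussianInt, ‖(p : ℂ) - z‖ ≤ r → p ∈ F) ∧
      (F.card : ℝ) ≤ (2 * r + 1) ^ 2 := by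
  classical
  have hcard : ∀ t : ℝ, ((Finset.Icc ⌈t - r⌉ ⌊t + r⌋).card : ℝ) ≤ 2 * r + 1 := by
    intro t
    rw [Int.card_Icc]
    have h1 : (((⌊t + r⌋ + 1 - ⌈t - r⌉).toNat : ℤ) : ℝ) ≤ 2 * r + 1 := by
      rw [Int.toNat_eq_max]
      push_cast
      refine max_le ?_ (by linarith)
      linarith [Int.floor_le (t + r), Int.le_ceil (t - r)]
    exact_mod_cast h1
  refine ⟨(Finset.Icc ⌈z.re - r⌉ ⌊z.re + r⌋ ×ˢ Finset.Icc ⌈z.im - r⌉ ⌊z.im + r⌋).image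
    fun a => (⟨a.1, a.2⟩ : GaussianInt), ?_, ?_⟩
  · intro p hp
    have h1 := abs_le.1 ((Complex.abs_re_le_norm _).trans hp)
    have h2 := abs_le.1 ((Complex.abs_im_le_norm _).trans hp)
    rw [Complex.sub_re, ← GaussianInt.intCast_re] at h1
    rw [Complex.sub_im, ← GaussianInt.intCast_im] at h2
    rw [Finset.mem_image]
    refine ⟨(p.re, p.im), ?_, rfl⟩
    simp only [Finset.mem_product, Finset.mem_Icc, Int.ceil_le, Int.le_floor]
    refine ⟨⟨?_, ?_⟩, ?_, ?_⟩ <;> linarith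
  · calc _ ≤ (((Finset.Icc ⌈z.re - r⌉ ⌊z.re + r⌋ ×ˢ
          Finset.Icc ⌈z.im - r⌉ ⌊z.im + r⌋).card : ℕ) : ℝ) := by
          exact_mod_cast Finset.card_image_le
      _ ≤ (2 * r + 1) ^ 2 := by
        rw [Finset.card_product, sq]
        push_cast
        have := hcard z.re
        have := hcard z.im
        gcongr

open MeasureTheory in
/-- The set of points of a ball without expansion rate in `[Q / 100, Q]` is small. -/
lemma volume_jump_le (x₀ : ℂ) {ρ : ℝ} (hρ : 0 < ρ) :
    ∃ Q₀ : ℝ, ∀ Q ≥ Q₀, volume {x | x ∈ Metric.closedBall x₀ ρ ∧ x ∈ regular ∧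
      ¬ ∃ k, 1 / 100 * Q ≤ expansionRate x k ∧ expansionRate x k ≤ Q} ≤
        ENNReal.ofReal (Real.pi * ρ ^ 2 / 8) := by
  classical
  -- For `|q| > A` the constant 18 in the count of numerators is absorbed, as `18 / |q|² ≤ ρ²`. The
  -- finitely many shorter `q` contribute `O(1 / Q²)`.
  set A : ℝ := 5 / ρ with hA
  have hApos : 0 < A := by positivity
  obtain ⟨FA, hFA, hFAc⟩ := exists_finset_gaussianInt 0 hApos.le
  -- `Q ≥ 100` gives `2 * (Q / 50) + 1 ≤ Q / 20`; the second bound makes the short denominators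
  -- contribute at most a tenth of the area. In total `9/400 + 1/10 < 1/8`.
  refine ⟨max 100 (18 * (2 * A + 1) ^ 2 * 10 / ρ ^ 2), fun Q hQ => ?_⟩
  have hQ1 : 100 ≤ Q := (le_max_left _ _).trans hQ
  have hQ2 : 18 * (2 * A + 1) ^ 2 * 10 / ρ ^ 2 ≤ Q := (le_max_right _ _).trans hQ
  have hQpos : 0 < Q := by linarith
  obtain ⟨Fq, hFq, hFqc⟩ := exists_finset_gaussianInt 0 (r := Q / 50) (by positivity)
  choose Fp hFp hFpc using fun q : GaussianInt => exists_finset_gaussianInt ((q : ℂ) * x₀)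
    (r := ρ * ‖(q : ℂ)‖ + 1 / Q) (by positivity)
  have hsub : {x | x ∈ Metric.closedBall x₀ ρ ∧ x ∈ regular ∧
      ¬ ∃ k, 1 / 100 * Q ≤ expansionRate x k ∧ expansionRate x k ≤ Q} ⊆
      ⋃ q ∈ Fq.filter (· ≠ 0), ⋃ p ∈ Fp q,
        Metric.closedBall ((p : ℂ) / q) (1 / (‖(q : ℂ)‖ * Q)) := by
    rintro x ⟨hxB, hxr, hx⟩
    obtain ⟨p, q, hq, h1, h2⟩ := exists_close_rational hxr (by linarith)
      (by norm_num) hx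
    have hq' : (q : ℂ) ≠ 0 := by simpa using hq
    rw [Metric.mem_closedBall, dist_eq_norm] at hxB
    simp only [Set.mem_iUnion]
    refine ⟨q, Finset.mem_filter.2 ⟨hFq q (by rw [sub_zero]; linarith), hq⟩, p, hFp q p ?_, ?_⟩
    · calc ‖(p : ℂ) - q * x₀‖ = ‖(q : ℂ) * (x - x₀) - (q * x - p)‖ := by congr 1; ring
        _ ≤ ‖(q : ℂ) * (x - x₀)‖ + ‖(q : ℂ) * x - p‖ := norm_sub_le _ _
        _ ≤ ρ * ‖(q : ℂ)‖ + 1 / Q := by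
          rw [norm_mul, mul_comm ρ]; gcongr
    · rw [Metric.mem_closedBall, dist_eq_norm]
      have e : x - (p : ℂ) / q = ((q : ℂ) * x - p) / q := by field_simp
      have e' : 1 / (‖(q : ℂ)‖ * Q) = 1 / Q / ‖(q : ℂ)‖ := by rw [div_div, mul_comm]
      rw [e, norm_div, e']
      gcongr
  have hball : ∀ (q : GaussianInt) (p : GaussianInt),
      volume (Metric.closedBall ((p : ℂ) / q) (1 / (‖(q : ℂ)‖ * Q))) =
        ENNReal.ofReal (Real.pi * (1 / (‖(q : ℂ)‖ * Q)) ^ 2) := by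
    intro q p
    rw [Complex.volume_closedBall, mul_comm, ENNReal.ofReal_mul Real.pi_pos.le,
      ENNReal.ofReal_pow (by positivity), ← NNReal.coe_real_pi, ENNReal.ofReal_coe_nnreal]
  have hterm : ∀ q ∈ Fq.filter (· ≠ 0),
      volume (⋃ p ∈ Fp q, Metric.closedBall ((p : ℂ) / q) (1 / (‖(q : ℂ)‖ * Q))) ≤
        ENNReal.ofReal (9 * Real.pi * ρ ^ 2 / Q ^ 2 +
          if q ∈ FA then 18 * Real.pi / Q ^ 2 else 0) := by
    intro q hq
    have hq0 : q ≠ 0 := (Finset.mem_filter.1 hq).2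
    have hq1 : 1 ≤ ‖(q : ℂ)‖ := by
      have h1 : (1 : ℤ) ≤ q.norm := GaussianInt.norm_pos.2 hq0
      have h2 := norm_coe_of_norm_eq (c := q) rfl
      have h3 : (1 : ℝ) ≤ (q.norm : ℝ) := by exact_mod_cast h1
      nlinarith [norm_nonneg (q : ℂ)]
    refine (measure_biUnion_finset_le _ _).trans ?_
    simp only [hball]
    rw [Finset.sum_const, ← ENNReal.ofReal_nsmul]
    apply ENNReal.ofReal_le_ofReal
    rw [nsmul_eq_mul]
    have hQinv : 1 / Q ≤ 1 := by rw [div_le_one hQpos]; linarith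
    set t := ‖(q : ℂ)‖ with ht
    have h1 : ((Fp q).card : ℝ) ≤ 8 * ρ ^ 2 * t ^ 2 + 18 := by
      refine (hFpc q).trans ?_
      have h2 : (2 * (ρ * t + 1 / Q) + 1) ^ 2 ≤ (2 * (ρ * t) + 3) ^ 2 := by
        apply pow_le_pow_left₀ (by positivity)
        linarith
      nlinarith [sq_nonneg (2 * (ρ * t) - 3)]
    have h2 : 18 / t ^ 2 ≤ ρ ^ 2 + if q ∈ FA then 18 else 0 := by
      split_ifs with hqA
      · have : 18 / t ^ 2 ≤ 18 := div_le_self (by norm_num) (by nlinarith)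
        nlinarith
      · have h3 : A < t := by
          by_contra hcon
          exact hqA (hFA q (by rw [sub_zero]; exact not_lt.1 hcon))
        rw [add_zero, div_le_iff₀ (by positivity)]
        have h4 : 5 < ρ * t := by
          rw [hA, div_lt_iff₀ hρ] at h3; linarith
        nlinarith
    calc ((Fp q).card : ℝ) * (Real.pi * (1 / (t * Q)) ^ 2)
        ≤ (8 * ρ ^ 2 * t ^ 2 + 18) * (Real.pi * (1 / (t * Q)) ^ 2) := by gcongr
      _ = (8 * ρ ^ 2 + 18 / t ^ 2) * (Real.pi / Q ^ 2) := by
          have : t ≠ 0 := by positivity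
          field_simp
      _ ≤ (8 * ρ ^ 2 + (ρ ^ 2 + if q ∈ FA then 18 else 0)) * (Real.pi / Q ^ 2) := by gcongr
      _ = _ := by split_ifs <;> ring
  refine (measure_mono hsub).trans ((measure_biUnion_finset_le _ _).trans
    ((Finset.sum_le_sum hterm).trans ?_))
  rw [← ENNReal.ofReal_sum_of_nonneg (fun q _ => by split_ifs <;> positivity)]
  apply ENNReal.ofReal_le_ofReal
  rw [Finset.sum_add_distrib, Finset.sum_const, nsmul_eq_mul, ← Finset.sum_filter,
    Finset.sum_const, nsmul_eq_mul]
  have c1 : (((Fq.filter (· ≠ 0)).card : ℕ) : ℝ) ≤ (Q / 20) ^ 2 := by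
    calc (((Fq.filter (· ≠ 0)).card : ℕ) : ℝ) ≤ (Fq.card : ℝ) := by
          exact_mod_cast Finset.card_filter_le _ _
      _ ≤ (2 * (Q / 50) + 1) ^ 2 := hFqc
      _ ≤ (Q / 20) ^ 2 := by
        apply pow_le_pow_left₀ (by positivity)
        linarith
  have c2 : ((((Fq.filter (· ≠ 0)).filter (· ∈ FA)).card : ℕ) : ℝ) ≤ (2 * A + 1) ^ 2 := by
    refine le_trans ?_ hFAc
    exact_mod_cast Finset.card_le_card fun q hq => (Finset.mem_filter.1 hq).2
  have c3 : (2 * A + 1) ^ 2 * (18 * Real.pi / Q ^ 2) ≤ Real.pi * ρ ^ 2 / 10 := by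
    rw [div_le_iff₀ (by positivity)] at hQ2
    rw [mul_div_assoc', div_le_iff₀ (by positivity)]
    have : Q * ρ ^ 2 ≤ Q ^ 2 * ρ ^ 2 := by gcongr; nlinarith
    nlinarith [Real.pi_pos]
  calc _ ≤ (Q / 20) ^ 2 * (9 * Real.pi * ρ ^ 2 / Q ^ 2) +
        (2 * A + 1) ^ 2 * (18 * Real.pi / Q ^ 2) := by gcongr
    _ = 9 / 400 * (Real.pi * ρ ^ 2) + (2 * A + 1) ^ 2 * (18 * Real.pi / Q ^ 2) := by
      congr 1
      field_simp
      norm_num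
    _ ≤ 9 / 400 * (Real.pi * ρ ^ 2) + Real.pi * ρ ^ 2 / 10 := by gcongr
    _ ≤ _ := by
      have : 0 < Real.pi * ρ ^ 2 := by positivity
      linarith

/-! ### Well approximable points -/

/-- The points with a good approximation whose expansion differs in at least `m` places. -/
def goodSet (ψ : ℝ → ℝ) (m : ℕ) : Set ℂ :=
  {y | y ∈ domainStar ∧ ∃ p q : GaussianInt, q ≠ 0 ∧ (p : ℂ) / q ∈ domainStar ∧
    ‖y - (p : ℂ) / q‖ ≤ ψ ‖(q : ℂ)‖ ∧ m ≤ diffCount y ((p : ℂ) / q)}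

/-- Each approximation is chosen to differ in more places than its predecessor. Strict growth of the
counts gives both divergence and distinctness of the fractions. -/
lemma mem_E_of_forall_mem_goodSet {ψ : ℝ → ℝ} {z : ℂ} (hz : z ∉ rationals)
    (h : ∀ m, z ∈ goodSet ψ m) : z ∈ E ψ := by
  choose p q hq hmem hle hd using fun m => (h m).2
  let a : ℕ → ℕ := fun n => Nat.rec 0 (fun _ k => diffCount z ((p k : ℂ) / q k) + 1) n
  have ha : ∀ n, a (n + 1) = diffCount z ((p (a n) : ℂ) / q (a n)) + 1 := fun n => rfl
  have hmono : StrictMono fun n => diffCount z ((p (a n) : ℂ) / q (a n)) := by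
    refine strictMono_nat_of_lt_succ fun n => ?_
    have h1 := hd (a (n + 1))
    have h2 := ha n
    omega
  refine ⟨(h 0).1, hz, fun n => p (a n), fun n => q (a n), fun n => hq _, ?_, fun n => hmem _,
    fun n => hle _, hmono.tendsto_atTop⟩
  intro i j hij
  exact hmono.injective (congrArg (diffCount z) hij)

lemma exists_ball_subset_goodSet {ψ : ℝ → ℝ} (hanti : AntitoneOn ψ (Set.Ioi 0)) (m : ℕ) :
    ∃ C : ℝ, 1 ≤ C ∧ ∀ x ∈ regular, ∀ Q : ℝ, 0 < Q →
      (∃ k, 1 / 100 * Q ≤ expansionRate x k ∧ expansionRate x k ≤ Q) →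
      ∀ τ : ℝ, 0 < τ → C * (τ * Q ^ 2) ≤ 1 → τ ≤ ψ (C * Q) →
      ∃ z : ℂ, ‖x - z‖ + τ / 512 ≤ C / Q ^ 2 ∧
        Metric.closedBall z (τ / 512) ⊆ goodSet ψ m := by
  obtain ⟨C, hC, h⟩ := exists_good_ball m (δ := 1 / 100) (by norm_num)
  refine ⟨C + 1, by linarith, fun x hx Q hQ hk τ hτ hτQ hψ => ?_⟩
  have hτQ0 : 0 < τ * Q ^ 2 := by positivity
  obtain ⟨p, q, hq, hP, hqn, hxP, z, hz, hball⟩ := h x hx Q hQ hk τ hτ (by nlinarith)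
  refine ⟨z, ?_, fun y hy => ⟨(hball y hy).1, p, q, hq, hP, ?_, (hball y hy).2⟩⟩
  · have h1 : ‖x - z‖ ≤ ‖x - (p : ℂ) / q‖ + ‖z - (p : ℂ) / q‖ := by
      rw [norm_sub_rev z]; exact norm_sub_le_norm_sub_add_norm_sub _ _ _
    have h2 : τ ≤ 1 / Q ^ 2 := by
      rw [le_div_iff₀ (by positivity)]; nlinarith
    rw [add_div]
    linarith
  · rw [Metric.mem_closedBall, dist_eq_norm] at hy
    have h1 : ‖y - (p : ℂ) / q‖ ≤ ‖y - z‖ + ‖z - (p : ℂ) / q‖ :=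
      norm_sub_le_norm_sub_add_norm_sub _ _ _
    have hqpos : 0 < ‖(q : ℂ)‖ := norm_pos_iff.2 (by simpa using hq)
    have h2 : ψ ((C + 1) * Q) ≤ ψ ‖(q : ℂ)‖ :=
      hanti hqpos (Set.mem_Ioi.2 (by positivity)) (by nlinarith)
    linarith

open MeasureTheory in
lemma volume_closedBall_eq (x : ℂ) {ρ : ℝ} (hρ : 0 ≤ ρ) :
    volume (Metric.closedBall x ρ) = ENNReal.ofReal (Real.pi * ρ ^ 2) := by
  rw [Complex.volume_closedBall, mul_comm, ENNReal.ofReal_mul Real.pi_pos.le,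
    ENNReal.ofReal_pow hρ, ← NNReal.coe_real_pi, ENNReal.ofReal_coe_nnreal]

open MeasureTheory in
/-- In a ball there are regular points without large jumps outside of any set of at most half the
measure of the ball. -/
lemma exists_regular_mem (x₀ : ℂ) {ρ : ℝ} (hρ : 0 < ρ)
    (hB : Metric.closedBall x₀ ρ ⊆ domain) :
    ∃ Q₀ : ℝ, ∀ Q ≥ Q₀, ∀ N : Set ℂ, volume N ≤ ENNReal.ofReal (Real.pi * ρ ^ 2 / 2) →
      ∃ x ∈ Metric.closedBall x₀ ρ, x ∈ regular ∧ x ∉ N ∧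
        ∃ k, 1 / 100 * Q ≤ expansionRate x k ∧ expansionRate x k ≤ Q := by
  obtain ⟨Q₀, hQ₀⟩ := volume_jump_le x₀ hρ
  refine ⟨Q₀, fun Q hQ N hN => ?_⟩
  by_contra hcon
  push Not at hcon
  have hpos : 0 < Real.pi * ρ ^ 2 := by positivity
  have hsub : Metric.closedBall x₀ ρ ⊆ (domain \ regular) ∪ (N ∪ {x | x ∈ Metric.closedBall x₀ ρ ∧
      x ∈ regular ∧ ¬ ∃ k, 1 / 100 * Q ≤ expansionRate x k ∧ expansionRate x k ≤ Q}) := by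
    intro x hx
    by_cases hr : x ∈ regular
    · by_cases hxN : x ∈ N
      · exact Or.inr (Or.inl hxN)
      · refine Or.inr (Or.inr ⟨hx, hr, ?_⟩)
        rintro ⟨k, h1, h2⟩
        exact absurd h2 (hcon x hx hr hxN k h1).not_ge
    · exact Or.inl ⟨hB hx, hr⟩
  have h1 := (measure_mono hsub).trans ((measure_union_le _ _).trans (add_le_add
    volume_domain_diff_regular.le ((measure_union_le _ _).trans (add_le_add hN (hQ₀ Q hQ)))))
  rw [volume_closedBall_eq x₀ hρ.le, zero_add, ← ENNReal.ofReal_add (by positivity) (by positivity),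
    ENNReal.ofReal_le_ofReal_iff (by positivity)] at h1
  linarith

/-- The good sets contain balls near each point of the fundamental domain. -/
lemma exists_goodSet_ball {ψ : ℝ → ℝ} (hpos : ∀ x, 0 < x → 0 < ψ x)
    (hanti : AntitoneOn ψ (Set.Ioi 0)) (m : ℕ) {x₀ : ℂ} {ε : ℝ} (hε : 0 < ε)
    (hB : Metric.closedBall x₀ ε ⊆ domain) :
    ∃ z r, 0 < r ∧ z ∈ Metric.closedBall x₀ (2 * ε) ∧ Metric.closedBall z r ⊆ goodSet ψ m := by
  obtain ⟨C, hC, h⟩ := exists_ball_subset_goodSet hanti m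
  obtain ⟨Q₀, hQ₀⟩ := exists_regular_mem x₀ hε hB
  set Q := max (max Q₀ 1) (C / ε) with hQ
  have hQ1 : 1 ≤ Q := (le_max_right _ _).trans (le_max_left _ _)
  have hQ2 : C / ε ≤ Q := le_max_right _ _
  obtain ⟨x, hx, hxr, -, hk⟩ := hQ₀ Q ((le_max_left _ _).trans (le_max_left _ _)) ∅ (by simp)
  have hCQ : 0 < C * Q := by positivity
  set τ := min (ψ (C * Q)) (1 / (C * Q ^ 2)) with hτ
  have hτ0 : 0 < τ := lt_min (hpos _ hCQ) (by positivity)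
  have hτ1 : C * (τ * Q ^ 2) ≤ 1 := by
    have : τ ≤ 1 / (C * Q ^ 2) := min_le_right _ _
    rw [le_div_iff₀ (by positivity)] at this
    linarith
  obtain ⟨z, hz, hball⟩ := h x hxr Q (by linarith) hk τ hτ0 hτ1 (min_le_left _ _)
  refine ⟨z, τ / 512, by positivity, ?_, hball⟩
  have h1 : C / Q ^ 2 ≤ ε := by
    rw [div_le_iff₀ hε] at hQ2
    rw [div_le_iff₀ (by positivity)]
    nlinarith
  rw [Metric.mem_closedBall, dist_eq_norm] at hx ⊢
  have h2 : ‖z - x₀‖ ≤ ‖x - z‖ + ‖x - x₀‖ := by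
    rw [norm_sub_rev x z]; exact norm_sub_le_norm_sub_add_norm_sub _ _ _
  linarith

/-! ### The lower bound for the Hausdorff dimension -/

open Classical in
/-- The part of the sum `∑ e_j ^ s` belonging to the balls of a family which meet `B`. -/
def meetingSum (s : ℝ) (z : ℕ → ℂ) (e : ℕ → ℝ) (B : Set ℂ) : ENNReal :=
  ∑' j, if (Metric.closedBall (z j) (e j) ∩ B).Nonempty then ENNReal.ofReal (e j ^ s) else 0

open MeasureTheory in
/-- From a ball, which the family of balls `closedBall (z j) (e j)` does not fill, one can pass to a
much smaller ball of good points, which the family does not fill either. -/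
lemma exists_smaller_ball {ψ : ℝ → ℝ} (hanti : AntitoneOn ψ (Set.Ioi 0)) {s l : ℝ} (hs0 : 0 < s)
    (hs2 : s < 2) (hl : 2 < l) (hsl : l * s < 4)
    (hfreq : ∃ᶠ X : ℝ in atTop, X ^ (-l) ≤ ψ X) (m : ℕ) :
    ∃ η : ℝ, 0 < η ∧ η ≤ (1 / 2) ^ m ∧ ∀ (x₀ : ℂ) (ρ : ℝ), 0 < ρ → ρ ≤ 1 →
      Metric.closedBall x₀ ρ ⊆ domain → ∀ (z : ℕ → ℂ) (e : ℕ → ℝ), (∀ j, 0 < e j) →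
      meetingSum s z e (Metric.closedBall x₀ ρ) ≤ ENNReal.ofReal (η * ρ ^ s) →
      ∀ η' : ℝ, 0 < η' → ∃ (x' : ℂ) (ρ' : ℝ), 0 < ρ' ∧ ρ' ≤ 1 ∧
        Metric.closedBall x' ρ' ⊆ Metric.closedBall x₀ ρ ∧
        Metric.closedBall x' ρ' ⊆ goodSet ψ m ∧
        meetingSum s z e (Metric.closedBall x' ρ') ≤ ENNReal.ofReal (η' * ρ' ^ s) := by
  classical
  obtain ⟨C, hC, hgood⟩ := exists_ball_subset_goodSet hanti m
  -- `η` depends on `m` only through `C`, and not on the ball, so in the iteration the target `η'`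
  -- can be the `η` of the next level.
  set η := min ((1 / 2 : ℝ) ^ m) (1 / (16 * (1 + C) ^ 2)) with hη
  have hηpos : 0 < η := lt_min (by positivity) (by positivity)
  have hη1 : η ≤ 1 := (min_le_left _ _).trans (pow_le_one₀ (by norm_num) (by norm_num))
  have hη2 : η * (16 * (1 + C) ^ 2) ≤ 1 := by
    rw [← le_div_iff₀ (by positivity)]; exact min_le_right _ _
  refine ⟨η, hηpos, min_le_left _ _, fun x₀ ρ hρ hρ1 hB z e he hS η' hη' => ?_⟩
  have hB2 : Metric.closedBall x₀ (ρ / 2) ⊆ domain :=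
    (Metric.closedBall_subset_closedBall (by linarith)).trans hB
  obtain ⟨Q₀, hQ₀⟩ := exists_regular_mem x₀ (half_pos hρ) hB2
  -- Here `4 - l * s > 0` is used: about `Q⁴` places for the new ball compete with its required sum
  -- `ρ' ^ s`, of order `X ^ (-l * s)`.
  obtain ⟨X, hXψ, hX1, hXQ, hXρ, hXη⟩ : ∃ X : ℝ, X ^ (-l) ≤ ψ X ∧ 1 ≤ X ∧ Q₀ ≤ X / C ∧
      2 * C ^ 3 / ρ ≤ X ∧
      16 * (1 + C) ^ 2 * C ^ 4 * 512 ^ s / (η' * ρ ^ 2) ≤ X ^ (4 - l * s) := by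
    have t1 : ∀ᶠ X : ℝ in atTop, 1 ≤ X := eventually_ge_atTop 1
    have t2 : ∀ᶠ X : ℝ in atTop, C * Q₀ ≤ X := eventually_ge_atTop _
    have t3 : ∀ᶠ X : ℝ in atTop, 2 * C ^ 3 / ρ ≤ X := eventually_ge_atTop _
    have t4 := (tendsto_rpow_atTop (by linarith : 0 < 4 - l * s)).eventually_ge_atTop
      (16 * (1 + C) ^ 2 * C ^ 4 * 512 ^ s / (η' * ρ ^ 2))
    obtain ⟨X, h0, ⟨h1, h2⟩, h3, h4⟩ := (hfreq.and_eventually ((t1.and t2).and (t3.and t4))).exists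
    refine ⟨X, h0, h1, ?_, h3, h4⟩
    rw [le_div_iff₀ (by linarith)]; linarith
  have hXpos : 0 < X := by linarith
  set Q := X / C with hQ
  have hQpos : 0 < Q := by positivity
  have hCQ : C * Q = X := by rw [hQ]; field_simp
  set τ := X ^ (-l) with hτ
  have hτpos : 0 < τ := by positivity
  have hτX : τ * X ^ 2 ≤ 1 := by
    rw [hτ, ← Real.rpow_natCast X 2, ← Real.rpow_add hXpos]
    apply Real.rpow_le_one_of_one_le_of_nonpos hX1
    push_cast; linarith
  have hX2 : 1 ≤ X ^ 2 := one_le_pow₀ hX1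
  have hτ1 : τ ≤ 1 := by nlinarith
  have hτQ : C * (τ * Q ^ 2) ≤ 1 := by
    have h2 : C * Q ^ 2 ≤ X ^ 2 := by
      calc C * Q ^ 2 = (C * Q) * Q := by ring
        _ = X * Q := by rw [hCQ]
        _ ≤ X ^ 2 := by nlinarith
    nlinarith
  set ρ' := τ / 512 with hρ'
  have hρ'pos : 0 < ρ' := by positivity
  set J : Set ℕ := {j | (Metric.closedBall (z j) (e j) ∩ Metric.closedBall x₀ ρ).Nonempty} with hJ
  have hJe : ∀ j ∈ J, e j ≤ ρ := by
    intro j hj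
    have h1 : ENNReal.ofReal (e j ^ s) ≤ meetingSum s z e (Metric.closedBall x₀ ρ) := by
      refine le_trans ?_ (ENNReal.le_tsum j)
      rw [if_pos (show (Metric.closedBall (z j) (e j) ∩ Metric.closedBall x₀ ρ).Nonempty from hj)]
    have h2 := (ENNReal.ofReal_le_ofReal_iff (by positivity)).1 (h1.trans hS)
    have h3 : e j ^ s ≤ ρ ^ s := by
      refine h2.trans ?_
      have : 0 < ρ ^ s := by positivity
      nlinarith
    exact (Real.rpow_le_rpow_iff (he j).le hρ.le hs0).1 h3
  set V : ℕ → Set ℂ := fun j => Metric.closedBall (z j) (e j + C / Q ^ 2) with hV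
  -- Balls larger than the displacement scale are avoided altogether: their area is controlled by `e
  -- j ^ 2 ≤ ρ ^ (2 - s) * e j ^ s`, and `η` makes the total small.
  set N₁ : Set ℂ := ⋃ j ∈ {j | j ∈ J ∧ 1 / Q ^ 2 ≤ e j}, V j with hN₁
  have hvN₁ : volume N₁ ≤ ENNReal.ofReal (Real.pi * (ρ / 2) ^ 2 / 4) := by
    have h1 : volume N₁ ≤ ∑' j, ENNReal.ofReal (Real.pi * (1 + C) ^ 2 * ρ ^ (2 - s)) *
        if j ∈ J then ENNReal.ofReal (e j ^ s) else 0 := by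
      rw [hN₁]
      refine (measure_iUnion_le _).trans (ENNReal.tsum_le_tsum fun j => ?_)
      by_cases hj : j ∈ J ∧ 1 / Q ^ 2 ≤ e j
      · have e1 : (⋃ (_ : j ∈ {j | j ∈ J ∧ 1 / Q ^ 2 ≤ e j}), V j) = V j :=
          Set.ext fun y => by
            simp only [Set.mem_iUnion]
            exact ⟨fun h => h.2, fun h => ⟨hj, h⟩⟩
        have hej := he j
        rw [e1, if_pos hj.1, volume_closedBall_eq _ (by positivity),
          ← ENNReal.ofReal_mul (by positivity)]
        apply ENNReal.ofReal_le_ofReal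
        have h2 : e j + C / Q ^ 2 ≤ (1 + C) * e j := by
          have : C / Q ^ 2 ≤ C * e j := by
            rw [div_eq_mul_one_div]; gcongr; exact hj.2
          linarith
        have h3 : e j ^ 2 ≤ ρ ^ (2 - s) * e j ^ s := by
          calc e j ^ 2 = e j ^ (2 - s) * e j ^ s := by
                rw [← Real.rpow_add hej, sub_add_cancel, ← Real.rpow_natCast]
                norm_num
            _ ≤ ρ ^ (2 - s) * e j ^ s := by
              gcongr
              exact hJe j hj.1
        calc Real.pi * (e j + C / Q ^ 2) ^ 2 ≤ Real.pi * ((1 + C) * e j) ^ 2 := by gcongr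
          _ = Real.pi * (1 + C) ^ 2 * e j ^ 2 := by ring
          _ ≤ Real.pi * (1 + C) ^ 2 * (ρ ^ (2 - s) * e j ^ s) := by gcongr
          _ = _ := by ring
      · have e1 : (⋃ (_ : j ∈ {j | j ∈ J ∧ 1 / Q ^ 2 ≤ e j}), V j) = ∅ :=
          Set.eq_empty_iff_forall_notMem.2 fun y hy => by
            simp only [Set.mem_iUnion] at hy
            exact hj hy.1
        rw [e1, measure_empty]
        exact zero_le
    rw [ENNReal.tsum_mul_left] at h1
    refine h1.trans ((mul_le_mul_right hS _).trans ?_)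
    rw [← ENNReal.ofReal_mul (by positivity)]
    apply ENNReal.ofReal_le_ofReal
    have h4 : ρ ^ (2 - s) * ρ ^ s = ρ ^ 2 := by
      rw [← Real.rpow_add hρ, sub_add_cancel, ← Real.rpow_natCast]; norm_num
    calc Real.pi * (1 + C) ^ 2 * ρ ^ (2 - s) * (η * ρ ^ s)
        = Real.pi * (ρ ^ (2 - s) * ρ ^ s) / 16 * (η * (16 * (1 + C) ^ 2)) := by ring
      _ ≤ Real.pi * ρ ^ 2 / 16 * 1 := by rw [h4]; gcongr
      _ = _ := by ring
  -- Small balls are handled on average. `f x` dominates their sum over those meeting any ball that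
  -- can arise from `x`; its integral is `O(Q⁻⁴)`, and Markov's inequality makes `f` exceed the
  -- target only on a small set.
  set f : ℂ → ENNReal := fun x => ∑' j, (V j).indicator
    (fun _ => if j ∈ J ∧ e j < 1 / Q ^ 2 then ENNReal.ofReal (e j ^ s) else 0) x with hf
  have hVmeas : ∀ j, MeasurableSet (V j) := fun j => Metric.isClosed_closedBall.measurableSet
  have hfint : ∫⁻ x, f x ≤ ENNReal.ofReal (Real.pi * (1 + C) ^ 2 / Q ^ 4 * (η * ρ ^ s)) := by
    rw [hf, lintegral_tsum fun j => (measurable_const.indicator (hVmeas j)).aemeasurable]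
    have h1 : ∀ j, ∫⁻ x, (V j).indicator
        (fun _ => if j ∈ J ∧ e j < 1 / Q ^ 2 then ENNReal.ofReal (e j ^ s) else 0) x ≤
        ENNReal.ofReal (Real.pi * (1 + C) ^ 2 / Q ^ 4) *
          if j ∈ J then ENNReal.ofReal (e j ^ s) else 0 := by
      intro j
      rw [lintegral_indicator_const (hVmeas j)]
      by_cases hj : j ∈ J ∧ e j < 1 / Q ^ 2
      · have hej := he j
        rw [if_pos hj, if_pos hj.1, mul_comm]
        gcongr
        rw [volume_closedBall_eq _ (by positivity)]
        apply ENNReal.ofReal_le_ofReal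
        calc Real.pi * (e j + C / Q ^ 2) ^ 2 ≤ Real.pi * (1 / Q ^ 2 + C / Q ^ 2) ^ 2 := by
              gcongr; exact hj.2.le
          _ = _ := by field_simp
      · rw [if_neg hj, zero_mul]
        exact zero_le
    refine (ENNReal.tsum_le_tsum h1).trans ?_
    rw [ENNReal.tsum_mul_left, ENNReal.ofReal_mul (by positivity)]
    gcongr
    exact hS
  set t := ENNReal.ofReal (η' * ρ' ^ s) with ht
  have htpos : 0 < η' * ρ' ^ s := by positivity
  set N₂ : Set ℂ := {x | t ≤ f x} with hN₂
  have hvN₂ : volume N₂ ≤ ENNReal.ofReal (Real.pi * (ρ / 2) ^ 2 / 4) := by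
    have hfm : Measurable f := Measurable.tsum fun j => measurable_const.indicator (hVmeas j)
    refine (meas_ge_le_lintegral_div hfm.aemeasurable (ENNReal.ofReal_pos.2 htpos).ne'
      ENNReal.ofReal_ne_top).trans ((ENNReal.div_le_div_right hfint _).trans ?_)
    rw [← ENNReal.ofReal_div_of_pos htpos]
    apply ENNReal.ofReal_le_ofReal
    rw [div_le_iff₀ htpos]
    have h1 : ρ' ^ s * 512 ^ s = X ^ (-(l * s)) := by
      rw [← Real.mul_rpow hρ'pos.le (by norm_num), hρ', div_mul_cancel₀ _ (by norm_num), hτ,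
        ← Real.rpow_mul hXpos.le]
      congr 1; ring
    have h2 : X ^ (4 - l * s) = X ^ 4 * X ^ (-(l * s)) := by
      rw [sub_eq_add_neg, Real.rpow_add hXpos, ← Real.rpow_natCast]; norm_num
    have hρs : ρ ^ s ≤ 1 := Real.rpow_le_one hρ.le hρ1 hs0.le
    rw [h2, ← h1, div_le_iff₀ (by positivity)] at hXη
    have hX4 : X ^ 4 = C ^ 4 * Q ^ 4 := by rw [← hCQ]; ring
    have h5 : 16 * (1 + C) ^ 2 ≤ Q ^ 4 * ρ' ^ s * (η' * ρ ^ 2) := by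
      rw [hX4] at hXη
      have hpos' : 0 < C ^ 4 * (512 : ℝ) ^ s := by positivity
      refine le_of_mul_le_mul_right ?_ hpos'
      calc _ = 16 * (1 + C) ^ 2 * C ^ 4 * 512 ^ s := by ring
        _ ≤ _ := hXη
        _ = _ := by ring
    calc Real.pi * (1 + C) ^ 2 / Q ^ 4 * (η * ρ ^ s) ≤ Real.pi * (1 + C) ^ 2 / Q ^ 4 * (1 * 1) := by
          gcongr
      _ = Real.pi / (16 * Q ^ 4) * (16 * (1 + C) ^ 2) := by field_simp
      _ ≤ Real.pi / (16 * Q ^ 4) * (Q ^ 4 * ρ' ^ s * (η' * ρ ^ 2)) := by gcongr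
      _ = _ := by field_simp; norm_num
  have hN : volume (N₁ ∪ N₂) ≤ ENNReal.ofReal (Real.pi * (ρ / 2) ^ 2 / 2) := by
    refine (measure_union_le _ _).trans ((add_le_add hvN₁ hvN₂).trans_eq ?_)
    rw [← ENNReal.ofReal_add (by positivity) (by positivity)]
    congr 1; ring
  obtain ⟨x, hx, hxr, hxN, hk⟩ := hQ₀ Q hXQ _ hN
  obtain ⟨x', hx', hball⟩ := hgood x hxr Q hQpos hk τ hτpos hτQ (by rw [hCQ]; exact hXψ)
  rw [Metric.mem_closedBall, dist_eq_norm] at hx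
  have hCρ : C / Q ^ 2 ≤ ρ / 2 := by
    rw [div_le_iff₀ hρ] at hXρ
    rw [div_le_iff₀ (by positivity), hQ, div_pow, mul_div_assoc', le_div_iff₀ (by positivity)]
    have : X * ρ ≤ X ^ 2 * ρ := by gcongr; nlinarith
    nlinarith
  have hsub : Metric.closedBall x' ρ' ⊆ Metric.closedBall x₀ ρ := by
    refine Metric.closedBall_subset_closedBall' ?_
    rw [dist_eq_norm]
    have h2 : ‖x' - x₀‖ ≤ ‖x - x'‖ + ‖x - x₀‖ := by
      rw [norm_sub_rev x x']; exact norm_sub_le_norm_sub_add_norm_sub _ _ _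
    linarith
  refine ⟨x', ρ', hρ'pos, by rw [hρ']; linarith, hsub, hball, ?_⟩
  have hxf : f x ≤ t := by
    by_contra hcon
    exact hxN (Or.inr (not_le.1 hcon).le)
  refine le_trans (ENNReal.tsum_le_tsum fun j => ?_) hxf
  by_cases hj : (Metric.closedBall (z j) (e j) ∩ Metric.closedBall x' ρ').Nonempty
  · have hjJ : j ∈ J := hj.mono (Set.inter_subset_inter_right _ hsub)
    obtain ⟨y, hy1, hy2⟩ := hj
    have hxV : x ∈ V j := by
      rw [Metric.mem_closedBall] at hy1 hy2
      rw [hV, Metric.mem_closedBall]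
      have h1 : dist x (z j) ≤ dist x x' + dist y x' + dist y (z j) := by
        rw [dist_comm y x']; exact dist_triangle4 _ _ _ _
      rw [dist_eq_norm x x'] at h1
      linarith
    have hsmall : e j < 1 / Q ^ 2 := by
      by_contra hcon
      refine hxN (Or.inl ?_)
      rw [hN₁]
      exact Set.mem_biUnion (show j ∈ {j | j ∈ J ∧ 1 / Q ^ 2 ≤ e j} from ⟨hjJ, not_lt.1 hcon⟩) hxV
    rw [if_pos ⟨y, hy1, hy2⟩, Set.indicator_of_mem hxV, if_pos ⟨hjJ, hsmall⟩]
  · rw [if_neg hj]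
    exact zero_le

open MeasureTheory in
/-- A set of Hausdorff measure zero is covered by balls with small sum. -/
lemma exists_ball_cover {s : ℝ} (hs : 0 < s) {A : Set ℂ} (hA : Measure.hausdorffMeasure s A = 0)
    {ε : ℝ} (hε : 0 < ε) :
    ∃ (z : ℕ → ℂ) (e : ℕ → ℝ), (∀ j, 0 < e j) ∧ (A ⊆ ⋃ j, Metric.closedBall (z j) (e j)) ∧
      ∑' j, ENNReal.ofReal (e j ^ s) ≤ ENNReal.ofReal ε := by
  have h1 : (⨅ (t : ℕ → Set ℂ) (_ : A ⊆ ⋃ n, t n) (_ : ∀ n, Metric.ediam (t n) ≤ 1),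
      ∑' n, ⨆ _ : (t n).Nonempty, Metric.ediam (t n) ^ s) < ENNReal.ofReal (ε / 2) := by
    refine lt_of_le_of_lt ?_ (ENNReal.ofReal_pos.2 (half_pos hε))
    rw [← hA, Measure.hausdorffMeasure_apply]
    exact le_iSup₂ (f := fun (r : ENNReal) (_ : 0 < r) =>
      ⨅ (t : ℕ → Set ℂ) (_ : A ⊆ ⋃ n, t n) (_ : ∀ n, Metric.ediam (t n) ≤ r),
      ∑' n, ⨆ _ : (t n).Nonempty, Metric.ediam (t n) ^ s) 1 one_pos
  simp only [iInf_lt_iff] at h1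
  obtain ⟨t, htA, htd, hts⟩ := h1
  obtain ⟨δ, hδ, hδs⟩ := ENNReal.exists_pos_sum_of_countable' (ENNReal.ofReal_pos.2 (half_pos hε)).ne' ℕ
  have hδtop : ∀ j, δ j ≠ ⊤ := fun j =>
    ((ENNReal.le_tsum j).trans_lt (hδs.trans ENNReal.ofReal_lt_top)).ne
  have hδpos : ∀ j, 0 < (δ j).toReal := fun j => ENNReal.toReal_pos (hδ j).ne' (hδtop j)
  have hz : ∀ j, ∃ z : ℂ, (t j).Nonempty → z ∈ t j := fun j => by
    by_cases h : (t j).Nonempty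
    · exact ⟨h.some, fun _ => h.some_mem⟩
    · exact ⟨0, fun h' => absurd h' h⟩
  choose z hz using hz
  set d : ℕ → ℝ := fun j => Metric.diam (t j) with hd
  have hd0 : ∀ j, 0 ≤ d j := fun j => Metric.diam_nonneg
  have hbd : ∀ j, Metric.ediam (t j) ≠ ⊤ := fun j => ((htd j).trans_lt ENNReal.one_lt_top).ne
  -- The summable correction makes all radii positive even for sets of diameter 0. Positivity gives
  -- the contradiction when `e j ^ s` is compared with `(1 / 2) ^ n`.
  set e : ℕ → ℝ := fun j => (d j ^ s + (δ j).toReal) ^ s⁻¹ with he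
  have hsum0 : ∀ j, 0 < d j ^ s + (δ j).toReal := fun j =>
    add_pos_of_nonneg_of_pos (Real.rpow_nonneg (hd0 j) s) (hδpos j)
  have hes : ∀ j, e j ^ s = d j ^ s + (δ j).toReal := fun j => by
    rw [he, ← Real.rpow_mul (hsum0 j).le, inv_mul_cancel₀ hs.ne', Real.rpow_one]
  have he0 : ∀ j, 0 < e j := fun j => Real.rpow_pos_of_pos (hsum0 j) _
  have hde : ∀ j, d j ≤ e j := fun j => by
    rw [← Real.rpow_le_rpow_iff (hd0 j) (he0 j).le hs, hes]
    linarith [hδpos j]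
  refine ⟨z, e, he0, ?_, ?_⟩
  · refine htA.trans (Set.iUnion_mono fun j y hy => ?_)
    rw [Metric.mem_closedBall]
    exact (Metric.dist_le_diam_of_mem' (hbd j) hy (hz j ⟨y, hy⟩)).trans (hde j)
  · have h2 : ∀ j, ENNReal.ofReal (e j ^ s) ≤
        (⨆ _ : (t j).Nonempty, Metric.ediam (t j) ^ s) + δ j := by
      intro j
      rw [hes, ENNReal.ofReal_add (Real.rpow_nonneg (hd0 j) s) (hδpos j).le,
        ENNReal.ofReal_toReal (hδtop j)]
      gcongr
      by_cases h : (t j).Nonempty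
      · rw [ciSup_pos h, ← ENNReal.ofReal_rpow_of_nonneg (hd0 j) hs.le]
        gcongr
        exact (ENNReal.ofReal_toReal (hbd j)).le
      · have : d j = 0 := by
          rw [Set.not_nonempty_iff_eq_empty] at h
          rw [hd]; simp [h]
        rw [this, Real.zero_rpow hs.ne', ENNReal.ofReal_zero]
        exact zero_le
    refine (ENNReal.tsum_le_tsum h2).trans ?_
    rw [ENNReal.tsum_add]
    refine (add_le_add hts.le hδs.le).trans_eq ?_
    rw [← ENNReal.ofReal_add (half_pos hε).le (half_pos hε).le, add_halves]

lemma rationals_countable : rationals.Countable := by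
  have : rationals ⊆ Set.range fun a : (ℤ × ℤ) × (ℤ × ℤ) =>
      ((⟨a.1.1, a.1.2⟩ : GaussianInt) : ℂ) / ((⟨a.2.1, a.2.2⟩ : GaussianInt) : ℂ) := by
    rintro w ⟨p, q, -, rfl⟩
    exact ⟨((p.re, p.im), (q.re, q.im)), rfl⟩
  exact (Set.countable_range _).mono this

-- Nested balls keep their meeting sums below `η n * ρ ^ s`. A cover ball containing the limit point
-- meets all of them, so its radius would have to be 0. Adjoining the countable set of rationals
-- removes the need to keep the limit point irrational.
open MeasureTheory in
theorem hausdorffMeasure_ne_zero {ψ : ℝ → ℝ} (hanti : AntitoneOn ψ (Set.Ioi 0)) {s l : ℝ}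
    (hs0 : 0 < s) (hs2 : s < 2) (hl : 2 < l) (hsl : l * s < 4)
    (hfreq : ∃ᶠ X : ℝ in atTop, X ^ (-l) ≤ ψ X) :
    Measure.hausdorffMeasure s (E ψ ∪ rationals) ≠ 0 := by
  intro h0
  choose η hη0 hη1 hstep using exists_smaller_ball hanti hs0 hs2 hl hsl hfreq
  obtain ⟨z, e, he, hcov, hsum⟩ := exists_ball_cover hs0 h0
    (ε := η 0 * (1 / 4) ^ s) (mul_pos (hη0 0) (by positivity))
  let P : ℕ → ℂ × ℝ → Prop := fun n b => 0 < b.2 ∧ b.2 ≤ 1 ∧ Metric.closedBall b.1 b.2 ⊆ domain ∧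
    meetingSum s z e (Metric.closedBall b.1 b.2) ≤ ENNReal.ofReal (η n * b.2 ^ s)
  have hnext : ∀ n (b : {b // P n b}), ∃ b' : {b // P (n + 1) b},
      Metric.closedBall b'.1.1 b'.1.2 ⊆ Metric.closedBall b.1.1 b.1.2 ∧
      Metric.closedBall b'.1.1 b'.1.2 ⊆ goodSet ψ n := by
    rintro n ⟨⟨x₀, ρ⟩, hρ0, hρ1, hB, hS⟩
    obtain ⟨x', ρ', h1, h2, h3, h4, h5⟩ := hstep n x₀ ρ hρ0 hρ1 hB z e he hS _ (hη0 (n + 1))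
    exact ⟨⟨(x', ρ'), h1, h2, h3.trans hB, h5⟩, h3, h4⟩
  choose next hnext1 hnext2 using hnext
  have hstart : P 0 (0, 1 / 4) := by
    refine ⟨by norm_num, by norm_num, ?_, ?_⟩
    · intro y hy
      rw [mem_closedBall_zero_iff] at hy
      refine openDomain_subset_domain ⟨?_, ?_⟩
      · exact ((Complex.abs_re_le_norm y).trans hy).trans_lt (by norm_num)
      · exact ((Complex.abs_im_le_norm y).trans hy).trans_lt (by norm_num)
    · refine le_trans (ENNReal.tsum_le_tsum fun j => ?_) hsum
      split_ifs
      · exact le_rfl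
      · exact zero_le
  let g : (n : ℕ) → {b // P n b} := fun n => Nat.rec ⟨(0, 1 / 4), hstart⟩ (fun n b => next n b) n
  have hg : ∀ n, g (n + 1) = next n (g n) := fun n => rfl
  let K : ℕ → Set ℂ := fun n => Metric.closedBall (g n).1.1 (g n).1.2
  obtain ⟨y, hy⟩ : (⋂ n, K n).Nonempty := by
    refine IsCompact.nonempty_iInter_of_sequence_nonempty_isCompact_isClosed K (fun n => ?_)
      (fun n => ?_) (isCompact_closedBall _ _) (fun n => Metric.isClosed_closedBall)
    · change Metric.closedBall (g (n + 1)).1.1 (g (n + 1)).1.2 ⊆ _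
      rw [hg]
      exact hnext1 n (g n)
    · exact Metric.nonempty_closedBall.2 (g n).2.1.le
  rw [Set.mem_iInter] at hy
  have hgood : ∀ m, y ∈ goodSet ψ m := by
    intro m
    have := hy (m + 1)
    change y ∈ Metric.closedBall (g (m + 1)).1.1 (g (m + 1)).1.2 at this
    rw [hg] at this
    exact hnext2 m (g m) this
  have hyE : y ∈ E ψ ∪ rationals := by
    by_cases hr : y ∈ rationals
    · exact Or.inr hr
    · exact Or.inl (mem_E_of_forall_mem_goodSet hr hgood)
  obtain ⟨j, hj⟩ := Set.mem_iUnion.1 (hcov hyE)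
  have hbound : ∀ n, e j ^ s ≤ (1 / 2 : ℝ) ^ n := by
    intro n
    obtain ⟨hp1, hp2, -, hp4⟩ := (g n).2
    have h1 : ENNReal.ofReal (e j ^ s) ≤ meetingSum s z e (K n) := by
      refine le_trans ?_ (ENNReal.le_tsum j)
      rw [if_pos ⟨y, hj, hy n⟩]
    have hpos : 0 < η n * (g n).1.2 ^ s := mul_pos (hη0 n) (Real.rpow_pos_of_pos hp1 s)
    have h2 := (ENNReal.ofReal_le_ofReal_iff hpos.le).1 (h1.trans hp4)
    have h3 : (g n).1.2 ^ s ≤ 1 := Real.rpow_le_one hp1.le hp2 hs0.le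
    have h4 := hη0 n
    calc e j ^ s ≤ η n * (g n).1.2 ^ s := h2
      _ ≤ η n * 1 := by gcongr
      _ ≤ _ := by rw [mul_one]; exact hη1 n
  have hpos : 0 < e j ^ s := Real.rpow_pos_of_pos (he j) s
  obtain ⟨n, hn⟩ := exists_pow_lt_of_lt_one hpos (by norm_num : (1 / 2 : ℝ) < 1)
  exact absurd (hbound n) hn.not_ge

theorem le_dimH_E {ψ : ℝ → ℝ} (hanti : AntitoneOn ψ (Set.Ioi 0)) {s l : ℝ}
    (hs0 : 0 < s) (hs2 : s < 2) (hl : 2 < l) (hsl : l * s < 4)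
    (hfreq : ∃ᶠ X : ℝ in atTop, X ^ (-l) ≤ ψ X) :
    ENNReal.ofReal s ≤ dimH (E ψ) := by
  have h := hausdorffMeasure_ne_zero hanti hs0 hs2 hl hsl hfreq
  have h1 := le_dimH_of_hausdorffMeasure_ne_zero (d := s.toNNReal) (s := E ψ ∪ rationals)
    (by rwa [Real.coe_toNNReal s hs0.le])
  rwa [dimH_union, rationals_countable.dimH_zero, max_eq_left (zero_le)] at h1

/-! ### The upper bound for the Hausdorff dimension -/

/-- The Gaussian integer with given coordinates. -/
def ofCoords (x : Fin 2 → ℤ) : GaussianInt := ⟨x 0, x 1⟩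

lemma norm_le_norm_ofCoords (x : Fin 2 → ℤ) : ‖x‖ ≤ ‖(ofCoords x : ℂ)‖ := by
  rw [pi_norm_le_iff_of_nonneg (norm_nonneg _)]
  intro i
  rw [Int.norm_eq_abs]
  fin_cases i
  · have := Complex.abs_re_le_norm (ofCoords x : ℂ)
    rwa [← GaussianInt.intCast_re] at this
  · have := Complex.abs_im_le_norm (ofCoords x : ℂ)
    rwa [← GaussianInt.intCast_im] at this

lemma norm_num_le_norm_denom {p q : GaussianInt} (hq : q ≠ 0) (h : (p : ℂ) / q ∈ domain) :
    ‖(p : ℂ)‖ ≤ ‖(q : ℂ)‖ := by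
  have h1 := norm_le_of_mem_domain h
  have h2 : 0 < ‖(q : ℂ)‖ := norm_pos_iff.2 (by simpa using hq)
  rw [norm_div, div_le_iff₀ h2] at h1
  linarith

open MeasureTheory in
theorem dimH_E_le {ψ : ℝ → ℝ} {s t : ℝ} (hs : 0 < s) (hst : 4 < t * s)
    (hev : ∀ᶠ X : ℝ in atTop, ψ X ≤ X ^ (-t)) : dimH (E ψ) ≤ ENNReal.ofReal s := by
  classical
  obtain ⟨X₀, hX₀⟩ := eventually_atTop.1 hev
  obtain ⟨F, hF, -⟩ := exists_finset_gaussianInt 0 (r := max X₀ 0) (le_max_right _ _)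
  -- `|q| ^ (-t s)` is split into two equal powers, one of which is at most the same power of `|p|`.
  -- The double sum is then a product of two planar lattice sums with exponent above 2.
  set a := t * s / 2 with ha
  have ha2 : 2 < a := by rw [ha]; linarith
  have hsum1 := EisensteinSeries.summable_one_div_norm_rpow ha2
  have hsum2 : Summable fun b : (Fin 2 → ℤ) × (Fin 2 → ℤ) =>
      (2 : ℝ) ^ s * (‖b.1‖ ^ (-a) * ‖b.2‖ ^ (-a)) := by
    refine Summable.mul_left _ (Summable.mul_of_nonneg hsum1 hsum1 ?_ ?_) <;>
    · intro x
      exact Real.rpow_nonneg (norm_nonneg _) _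
  set w : (Fin 2 → ℤ) × (Fin 2 → ℤ) → ENNReal := fun b =>
    ENNReal.ofReal ((2 : ℝ) ^ s * (‖b.1‖ ^ (-a) * ‖b.2‖ ^ (-a))) with hw
  have hwsum : ∑' b, w b ≠ ⊤ := hsum2.tsum_ofReal_ne_top
  set ball : (Fin 2 → ℤ) × (Fin 2 → ℤ) → Set ℂ := fun b =>
    if b.1 ≠ 0 ∧ b.2 ≠ 0 ∧ ‖(ofCoords b.1 : ℂ)‖ ≤ ‖(ofCoords b.2 : ℂ)‖ then
      Metric.closedBall ((ofCoords b.1 : ℂ) / ofCoords b.2) (‖(ofCoords b.2 : ℂ)‖ ^ (-t))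
    else ∅ with hball
  have hdiam : ∀ b, Metric.ediam (ball b) ^ s ≤ w b := by
    intro b
    rw [hball]
    dsimp only
    split_ifs with hb
    · obtain ⟨h1, h2, h3⟩ := hb
      have n1 : 0 < ‖b.1‖ := norm_pos_iff.2 h1
      have n2 : 0 < ‖b.2‖ := norm_pos_iff.2 h2
      have m1 := norm_le_norm_ofCoords b.1
      have m2 := norm_le_norm_ofCoords b.2
      set N := ‖(ofCoords b.2 : ℂ)‖ with hN
      have hNpos : 0 < N := by linarith
      have e1 : Metric.ediam (Metric.closedBall ((ofCoords b.1 : ℂ) / ofCoords b.2) (N ^ (-t))) ≤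
          ENNReal.ofReal (2 * N ^ (-t)) := by
        have h0 : 0 ≤ N ^ (-t) := by positivity
        exact Metric.ediam_le_of_forall_dist_le fun x hx y hy => by
          rw [Metric.mem_closedBall] at hx hy
          have := dist_triangle_right x y ((ofCoords b.1 : ℂ) / ofCoords b.2)
          linarith
      refine (ENNReal.rpow_le_rpow e1 hs.le).trans ?_
      rw [ENNReal.ofReal_rpow_of_nonneg (by positivity) hs.le]
      apply ENNReal.ofReal_le_ofReal
      rw [Real.mul_rpow (by norm_num) (by positivity), ← Real.rpow_mul hNpos.le]
      gcongr
      have e2 : N ^ (-t * s) = N ^ (-a) * N ^ (-a) := by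
        rw [← Real.rpow_add hNpos]; congr 1; rw [ha]; ring
      rw [e2]
      have e3 : N ^ (-a) ≤ ‖b.1‖ ^ (-a) :=
        Real.rpow_le_rpow_of_nonpos n1 (m1.trans h3) (by linarith)
      have e4 : N ^ (-a) ≤ ‖b.2‖ ^ (-a) := Real.rpow_le_rpow_of_nonpos n2 m2 (by linarith)
      gcongr
    · rw [Metric.ediam_empty, ENNReal.zero_rpow_of_pos hs]
      exact zero_le
  have htail := ENNReal.tendsto_tsum_compl_atTop_zero hwsum
  -- Infinitely many distinct fractions approximate each point, so any finite set of pairs may be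
  -- discarded, as may the finitely many with `|p| ≤ |q| < X₀`.
  have hcover : ∀ S : Finset ((Fin 2 → ℤ) × (Fin 2 → ℤ)),
      E ψ ⊆ ⋃ b : {b // b ∉ S}, ball b.1 := by
    rintro S z ⟨hz, -, p, q, hq, hinj, hmem, hle, -⟩
    set c : ℕ → (Fin 2 → ℤ) × (Fin 2 → ℤ) := fun n => (![(p n).re, (p n).im], ![(q n).re, (q n).im])
      with hc
    have hc1 : ∀ n, ofCoords (c n).1 = p n := fun n => by simp [hc, ofCoords]
    have hc2 : ∀ n, ofCoords (c n).2 = q n := fun n => by simp [hc, ofCoords]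
    have hcinj : Function.Injective c := by
      intro i j hij
      apply hinj
      change (p i : ℂ) / q i = p j / q j
      rw [← hc1, ← hc2, hij, hc1, hc2]
    have hpqinj : Function.Injective fun n => (p n, q n) := by
      intro i j hij
      apply hinj
      rw [Prod.mk.injEq] at hij
      change (p i : ℂ) / q i = p j / q j
      rw [hij.1, hij.2]
    have hfin : {n | c n ∈ S ∨ (p n, q n) ∈ F ×ˢ F}.Finite := by
      refine Set.Finite.union (S.finite_toSet.preimage hcinj.injOn)
        ((F ×ˢ F).finite_toSet.preimage hpqinj.injOn)
    obtain ⟨n, hn⟩ := hfin.infinite_compl.nonempty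
    rw [Set.mem_compl_iff, Set.mem_ofPred_eq, not_or] at hn
    have hpq := norm_num_le_norm_denom (hq n) (hmem n).1
    have hqX : X₀ ≤ ‖(q n : ℂ)‖ := by
      by_contra hcon
      refine hn.2 (Finset.mem_product.2 ⟨hF _ ?_, hF _ ?_⟩)
      · rw [sub_zero]; exact hpq.trans ((not_le.1 hcon).le.trans (le_max_left _ _))
      · rw [sub_zero]; exact (not_le.1 hcon).le.trans (le_max_left _ _)
    refine Set.mem_iUnion.2 ⟨⟨c n, hn.1⟩, ?_⟩
    have hp0 : p n ≠ 0 := by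
      intro h0
      apply (hmem n).2
      rw [h0]; simp
    have hb : (c n).1 ≠ 0 ∧ (c n).2 ≠ 0 ∧ ‖(ofCoords (c n).1 : ℂ)‖ ≤ ‖(ofCoords (c n).2 : ℂ)‖ := by
      refine ⟨fun h0 => hp0 ?_, fun h0 => hq n ?_, by rw [hc1, hc2]; exact hpq⟩
      · rw [← hc1, h0]; rfl
      · rw [← hc2, h0]; rfl
    rw [hball]
    dsimp only
    rw [if_pos hb, hc1, hc2, Metric.mem_closedBall, dist_eq_norm]
    exact (hle n).trans (hX₀ _ hqX)
  have hmeas : Measure.hausdorffMeasure s (E ψ) ≤ 0 := by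
    have hr : Tendsto (fun S : Finset ((Fin 2 → ℤ) × (Fin 2 → ℤ)) =>
        (∑' b : {b // b ∉ S}, w b) ^ s⁻¹) atTop (𝓝 0) := by
      have := (ENNReal.continuous_rpow_const (y := s⁻¹)).tendsto 0
      rw [ENNReal.zero_rpow_of_pos (inv_pos.2 hs)] at this
      exact this.comp htail
    refine (Measure.hausdorffMeasure_le_liminf_tsum s (E ψ) _ hr
      (fun S (b : {b // b ∉ S}) => ball b.1) (Eventually.of_forall fun S b => ?_)
      (Eventually.of_forall hcover)).trans ?_
    · have h1 : Metric.ediam (ball b.1) ^ s ≤ ∑' b : {b // b ∉ S}, w b :=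
        (hdiam b.1).trans (ENNReal.le_tsum (f := fun b : {b // b ∉ S} => w b.1) b)
      rwa [ENNReal.le_rpow_inv_iff hs]
    · refine (liminf_le_liminf (Eventually.of_forall fun S =>
        ENNReal.tsum_le_tsum fun b : {b // b ∉ S} => hdiam b.1)).trans ?_
      exact htail.liminf_eq.le
  refine dimH_le_of_hausdorffMeasure_ne_top (d := s.toNNReal) ?_
  rw [Real.coe_toNNReal s hs.le, nonpos_iff_eq_zero.1 hmeas]
  exact ENNReal.zero_ne_top

end Hurwitz
end

/-! ### Packing premeasure of bounded sets and of somewhere dense sets -/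

noncomputable section
namespace Packing

lemma premeasure_empty (s : ℝ) : premeasure s ∅ = 0 := by
  refine nonpos_iff_eq_zero.1 (iInf₂_le_of_le 1 one_pos (iSup₂_le fun S hS => ?_))
  have : S = ∅ := Set.eq_empty_iff_forall_notMem.2 fun b hb => (hS.2.1 b hb).1
  subst this
  simp

lemma packingMeasure_le_premeasure (s : ℝ) (F : Set ℂ) : packingMeasure s F ≤ premeasure s F := by
  refine iInf₂_le_of_le (fun i => if i = 0 then F else ∅)
    (Set.subset_iUnion_of_subset 0 (by simp)) ?_
  rw [tsum_eq_single 0]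
  · simp
  · intro i hi
    dsimp only
    rw [if_neg hi, premeasure_empty]

-- For diameters at most 1, `(2r) ^ s ≤ 4r² ≤ 2πr²`, so a packing sum is at most twice the area of a
-- disc containing all the balls.
open MeasureTheory in
lemma packingMeasure_ne_top_of_bounded {F : Set ℂ} (hF : F ⊆ Metric.closedBall 0 1) {s : ℝ}
    (hs : 2 ≤ s) : packingMeasure s F ≠ ⊤ := by
  refine ne_top_of_le_ne_top ?_ (packingMeasure_le_premeasure s F)
  have h2 : premeasure s F ≤ volume (Metric.closedBall (0 : ℂ) 2) * 2 := by
    refine iInf₂_le_of_le (1 / 2) (by norm_num) (iSup₂_le fun S hS => ?_)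
    have h1 : ∀ b : S, (ENNReal.ofReal (2 * b.1.2)) ^ s ≤
        volume (Metric.closedBall b.1.1 b.1.2) * 2 := by
      intro b
      obtain ⟨-, hb0, hb1⟩ := hS.2.1 b.1 b.2
      rw [Hurwitz.volume_closedBall_eq _ hb0.le, ENNReal.ofReal_rpow_of_pos (by linarith)]
      have : (2 * b.1.2) ^ s ≤ (2 * b.1.2) ^ (2 : ℝ) :=
        Real.rpow_le_rpow_of_exponent_ge (by linarith) (by linarith) hs
      have h22 : ENNReal.ofReal 2 = 2 := by simp
      rw [← h22, ← ENNReal.ofReal_mul (by positivity)]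
      apply ENNReal.ofReal_le_ofReal
      refine this.trans ?_
      rw [Real.rpow_two]
      nlinarith [Real.pi_gt_three, sq_nonneg b.1.2]
    refine (ENNReal.tsum_le_tsum h1).trans ?_
    rw [ENNReal.tsum_mul_right, ← measure_biUnion hS.1 hS.2.2
      fun b _ => Metric.isClosed_closedBall.measurableSet]
    gcongr
    refine Set.iUnion₂_subset fun b hb => Metric.closedBall_subset_closedBall' ?_
    obtain ⟨h3, -, h4⟩ := hS.2.1 b hb
    have := Metric.mem_closedBall.1 (hF h3)
    linarith
  exact ne_top_of_le_ne_top (ENNReal.mul_ne_top measure_closedBall_lt_top.ne (by simp)) h2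

/-- A set which is dense in a ball has infinite packing premeasure in dimensions below `2`. -/
lemma premeasure_eq_top {A : Set ℂ} {x : ℂ} {ρ : ℝ} (hρ : 0 < ρ)
    (hA : Metric.ball x ρ ⊆ closure A) {s : ℝ} (hs : s < 2) : premeasure s A = ⊤ := by
  refine iInf₂_eq_top.2 fun δ hδ => ENNReal.eq_top_of_forall_nnreal_le fun M => ?_
  have t1 : Tendsto (fun N : ℕ => (N : ℝ) ^ (2 - s) * (ρ / 4) ^ s) atTop atTop :=
    ((tendsto_rpow_atTop (by linarith)).comp tendsto_natCast_atTop_atTop).atTop_mul_const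
      (by positivity)
  have t2 : Tendsto (fun N : ℕ => ρ / 8 / (N : ℝ)) atTop (𝓝 0) :=
    tendsto_const_div_atTop_nhds_zero_nat _
  obtain ⟨N, ⟨hN1, hN2⟩, hN3⟩ := ((t1.eventually_ge_atTop (M : ℝ)).and
    (t2.eventually_le_const hδ) |>.and (eventually_ge_atTop 1)).exists
  have hNpos : (0 : ℝ) < N := by exact_mod_cast hN3
  -- A grid of `N²` points with spacing `4r` fits into the ball. Moving its points by less than `r /
  -- 2` into `A` keeps balls of radius `r` disjoint, and the sum `N² (ρ / (4N)) ^ s` is unbounded in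
  -- `N`.
  set r := ρ / 8 / (N : ℝ) with hr
  have hr0 : 0 < r := by positivity
  have hrN : 8 * r * N = ρ := by rw [hr]; field_simp
  set c : Fin N × Fin N → ℂ := fun k => x + ((4 * r * (k.1 : ℕ) : ℝ) : ℂ) +
    ((4 * r * (k.2 : ℕ) : ℝ) : ℂ) * Complex.I with hc
  have hcA : ∀ k, ∃ a ∈ A, dist (c k) a < r / 2 := by
    intro k
    refine Metric.mem_closure_iff.1 (hA ?_) (r / 2) (by positivity)
    have b1 : ((k.1 : ℕ) : ℝ) < N := by exact_mod_cast k.1.2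
    have b2 : ((k.2 : ℕ) : ℝ) < N := by exact_mod_cast k.2.2
    rw [Metric.mem_ball, dist_eq_norm]
    calc ‖c k - x‖ = ‖((4 * r * (k.1 : ℕ) : ℝ) : ℂ) +
          ((4 * r * (k.2 : ℕ) : ℝ) : ℂ) * Complex.I‖ := by rw [hc]; congr 1; ring
      _ ≤ ‖((4 * r * (k.1 : ℕ) : ℝ) : ℂ)‖ + ‖((4 * r * (k.2 : ℕ) : ℝ) : ℂ) * Complex.I‖ :=
          norm_add_le _ _
      _ = 4 * r * (k.1 : ℕ) + 4 * r * (k.2 : ℕ) := by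
          rw [norm_mul, Complex.norm_I, mul_one, Complex.norm_real, Complex.norm_real,
            Real.norm_of_nonneg (by positivity), Real.norm_of_nonneg (by positivity)]
      _ < 4 * r * N + 4 * r * N := by gcongr
      _ = ρ := by rw [← hrN]; ring
  choose a haA hac using hcA
  have hsep : ∀ k k', k ≠ k' → 4 * r ≤ dist (c k) (c k') := by
    intro k k' hkk
    have hint : ∀ i j : Fin N, i ≠ j → 4 * r ≤ |4 * r * (i : ℕ) - 4 * r * (j : ℕ)| := by
      intro i j hij
      have h1 : (1 : ℤ) ≤ |((i : ℕ) : ℤ) - ((j : ℕ) : ℤ)| := by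
        apply Int.one_le_abs
        intro h0
        exact hij (Fin.ext (by omega))
      have h2 : (1 : ℝ) ≤ |((i : ℕ) : ℝ) - ((j : ℕ) : ℝ)| := by exact_mod_cast h1
      rw [← mul_sub, abs_mul, abs_of_pos (by positivity : 0 < 4 * r)]
      nlinarith
    rw [dist_eq_norm]
    by_cases h1 : k.1 = k'.1
    · have h2 : k.2 ≠ k'.2 := fun h => hkk (Prod.ext h1 h)
      refine (hint _ _ h2).trans (le_trans (le_of_eq ?_) (Complex.abs_im_le_norm _))
      simp [hc]
    · refine (hint _ _ h1).trans (le_trans (le_of_eq ?_) (Complex.abs_re_le_norm _))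
      simp [hc]
  have hasep : ∀ k k', k ≠ k' → r + r < dist (a k) (a k') := by
    intro k k' hkk
    have h1 := hsep k k' hkk
    have h2 := dist_triangle4 (c k) (a k) (a k') (c k')
    have h3 := hac k
    have h4 := hac k'
    rw [dist_comm (c k')] at h4
    linarith
  have hinj : Function.Injective fun k => (a k, r) := by
    intro k k' h
    by_contra hkk
    have := hasep k k' hkk
    rw [(Prod.mk.inj h).1, dist_self] at this
    linarith
  have hpack : IsPacking δ A (Set.range fun k => (a k, r)) := by
    refine ⟨Set.countable_range _, ?_, ?_⟩
    · rintro b ⟨k, rfl⟩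
      exact ⟨haA k, hr0, hN2⟩
    · rintro b ⟨k, rfl⟩ b' ⟨k', rfl⟩ hbb
      have hkk : k ≠ k' := fun h => hbb (by rw [h])
      exact Metric.closedBall_disjoint_closedBall (hasep k k' hkk)
  refine le_trans ?_ (le_iSup₂ (f := fun (S : Set (ℂ × ℝ)) (_ : IsPacking δ A S) =>
    ∑' b : S, ENNReal.ofReal (2 * b.1.2) ^ s) _ hpack)
  rw [tsum_range (f := fun b : ℂ × ℝ => ENNReal.ofReal (2 * b.2) ^ s) hinj, tsum_fintype]
  dsimp only
  rw [Finset.sum_const, Finset.card_univ, Fintype.card_prod, Fintype.card_fin,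
    ENNReal.ofReal_rpow_of_pos (by positivity), ← ENNReal.ofReal_nsmul, ← ENNReal.ofReal_coe_nnreal]
  apply ENNReal.ofReal_le_ofReal
  refine hN1.trans (le_of_eq ?_)
  have e : 2 * r = ρ / 4 / N := by rw [hr]; ring
  rw [e, nsmul_eq_mul, Real.div_rpow (by positivity) hNpos.le, Real.rpow_sub hNpos, Real.rpow_two]
  push_cast
  ring

end Packing

/-! ### Baire category and the packing dimension -/

namespace Hurwitz

/-- No countable union of nowhere dense sets covers the set `E ψ`. -/
lemma exists_dense_in_ball {ψ : ℝ → ℝ} (hpos : ∀ x, 0 < x → 0 < ψ x)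
    (hanti : AntitoneOn ψ (Set.Ioi 0)) {G : ℕ → Set ℂ} (hG : E ψ ⊆ ⋃ i, G i) :
    ∃ i x ρ, 0 < ρ ∧ Metric.ball x ρ ⊆ closure (G i) := by
  by_contra hcon
  have hnd : ∀ i, Dense (closure (G i))ᶜ := by
    intro i
    rw [← interior_eq_empty_iff_dense_compl, Set.eq_empty_iff_forall_notMem]
    intro x hx
    obtain ⟨ρ, hρ, h⟩ := Metric.mem_nhds_iff.1 (mem_interior_iff_mem_nhds.1 hx)
    exact hcon ⟨i, x, ρ, hρ, h⟩
  have r1 : ∀ᶠ y in residual ℂ, ∀ i, y ∈ (closure (G i))ᶜ :=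
    eventually_countable_forall.2 fun i =>
      residual_of_dense_open isClosed_closure.isOpen_compl (hnd i)
  have r2 : ∀ᶠ y in residual ℂ, y ∉ rationals := by
    have : ∀ᶠ y in residual ℂ, ∀ w ∈ rationals, y ∈ ({w}ᶜ : Set ℂ) :=
      (eventually_countable_ball rationals_countable).2 fun w _ =>
        residual_of_dense_open isOpen_compl_singleton (dense_compl_singleton w)
    filter_upwards [this] with y hy hyr
    exact hy y hyr rfl
  -- The good sets are dense only in the square; adding its exterior gives dense open subsets of the
  -- plane.
  have r3 : ∀ᶠ y in residual ℂ, ∀ m, y ∈ interior (goodSet ψ m) ∪ (closure openDomain)ᶜ := by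
    refine eventually_countable_forall.2 fun m => residual_of_dense_open
      (isOpen_interior.union isClosed_closure.isOpen_compl) ?_
    rw [dense_iff_inter_open]
    rintro U hU ⟨x, hx⟩
    by_cases hUO : (U ∩ openDomain).Nonempty
    · obtain ⟨x₀, hx₀⟩ := hUO
      obtain ⟨ε, hε, hball⟩ := Metric.isOpen_iff.1 (hU.inter isOpen_openDomain) x₀ hx₀
      have hsub : Metric.closedBall x₀ (2 * (ε / 4)) ⊆ U ∩ openDomain :=
        (Metric.closedBall_subset_ball (by linarith)).trans hball
      obtain ⟨z, r, hr, hz, hgood⟩ := exists_goodSet_ball hpos hanti m (ε := ε / 4) (by positivity)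
        (fun y hy => openDomain_subset_domain
          (hsub (Metric.closedBall_subset_closedBall (by linarith) hy)).2)
      refine ⟨z, (hsub hz).1, Or.inl (mem_interior_iff_mem_nhds.2 ?_)⟩
      exact Filter.mem_of_superset (Metric.closedBall_mem_nhds z hr) hgood
    · refine ⟨x, hx, Or.inr fun hxc => hUO ?_⟩
      exact mem_closure_iff.1 hxc U hU hx
  obtain ⟨y, hyO, hy1, hy2, hy3⟩ := (dense_of_mem_residual (r1.and (r2.and r3))).inter_open_nonempty
    openDomain isOpen_openDomain ⟨0, by constructor <;> norm_num⟩
  have hyE : y ∈ E ψ := mem_E_of_forall_mem_goodSet hy2 fun m => by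
    rcases hy3 m with h | h
    · exact interior_subset h
    · exact absurd (subset_closure hyO) h
  obtain ⟨i, hi⟩ := Set.mem_iUnion.1 (hG hyE)
  exact hy1 i (subset_closure hi)

theorem dimP_E {ψ : ℝ → ℝ} (hpos : ∀ x, 0 < x → 0 < ψ x)
    (hanti : AntitoneOn ψ (Set.Ioi 0)) : Packing.dimP (E ψ) = 2 := by
  refine le_antisymm (iSup₂_le fun s hs => ?_) (le_of_forall_lt fun c hc => ?_)
  · by_contra hcon
    have h2 : (2 : ℝ) ≤ s := by
      have : (2 : ENNReal) < s := not_le.1 hcon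
      have h3 : (2 : NNReal) < s := by exact_mod_cast this
      exact_mod_cast h3.le
    refine Packing.packingMeasure_ne_top_of_bounded (fun z hz => ?_) h2 hs
    rw [mem_closedBall_zero_iff]
    have := norm_le_of_mem_domain hz.1.1
    linarith
  · obtain ⟨s, hcs, hs2⟩ := ENNReal.lt_iff_exists_nnreal_btwn.1 hc
    refine hcs.trans_le (le_iSup₂_of_le s ?_ le_rfl)
    have hs : (s : ℝ) < 2 := by
      have h3 : s < (2 : NNReal) := by exact_mod_cast hs2
      exact_mod_cast h3
    refine iInf₂_eq_top.2 fun G hG => ?_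
    obtain ⟨i, x, ρ, hρ, hball⟩ := exists_dense_in_ball hpos hanti hG
    exact ENNReal.tsum_eq_top_of_eq_top ⟨i, Packing.premeasure_eq_top hρ hball hs⟩

/-! ### The Hausdorff dimension -/

lemma rpow_neg_of_lt {X y t : ℝ} (hX : 1 < X) (hy : 0 < y) (h : t < -Real.log y / Real.log X) :
    y ≤ X ^ (-t) := by
  have hl := Real.log_pos hX
  rw [lt_div_iff₀ hl] at h
  rw [← Real.log_le_log_iff hy (by positivity), Real.log_rpow (by linarith)]
  linarith

lemma rpow_neg_of_gt {X y t : ℝ} (hX : 1 < X) (hy : 0 < y) (h : -Real.log y / Real.log X < t) :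
    X ^ (-t) ≤ y := by
  have hl := Real.log_pos hX
  rw [div_lt_iff₀ hl] at h
  rw [← Real.log_le_log_iff (by positivity) hy, Real.log_rpow (by linarith)]
  linarith

theorem dimH_E {ψ : ℝ → ℝ} (hpos : ∀ x, 0 < x → 0 < ψ x) (hanti : AntitoneOn ψ (Set.Ioi 0)) :
    dimH (E ψ) = min (4 / (lowerOrder ψ).toENNReal) 2 := by
  refine le_antisymm (le_min ?_ ?_) (le_of_forall_lt fun c hc => ?_)
  · refine le_of_forall_gt fun c hc => ?_
    obtain ⟨s, hs, hsc⟩ := ENNReal.lt_iff_exists_nnreal_btwn.1 hc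
    refine lt_of_le_of_lt ?_ hsc
    have hs0 : 0 < s := by
      have : (0 : ENNReal) < s := (zero_le).trans_lt hs
      exact_mod_cast this
    have hL : ((4 / s : NNReal) : ENNReal) < (lowerOrder ψ).toENNReal := by
      rw [ENNReal.coe_div hs0.ne']
      have h1 := hs
      rw [ENNReal.div_lt_iff (Or.inr (by simp)) (Or.inr (by simp)), mul_comm] at h1
      rw [ENNReal.div_lt_iff (Or.inl (by exact_mod_cast hs0.ne')) (Or.inl (by simp))]
      exact_mod_cast h1
    have hL' : (((4 / s : NNReal) : ℝ) : EReal) < lowerOrder ψ := by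
      by_contra hcon
      have h1 := EReal.toENNReal_le_toENNReal (not_lt.1 hcon)
      rw [EReal.toENNReal_of_ne_top (x := (((4 / s : NNReal) : ℝ) : EReal)) (EReal.coe_ne_top _)] at h1
      simp only [EReal.toReal_coe, ENNReal.ofReal_coe_nnreal] at h1
      exact absurd hL h1.not_gt
    -- Any `t` strictly between `4 / s` and the lower order eventually bounds `ψ` by `X ^ (-t)`,
    -- with `t * s > 4`.
    obtain ⟨t, ht1, ht2⟩ := EReal.lt_iff_exists_real_btwn.1 hL'
    have ht1' : ((4 / s : NNReal) : ℝ) < t := by exact_mod_cast ht1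
    rw [NNReal.coe_div, div_lt_iff₀ (by exact_mod_cast hs0)] at ht1'
    have hev : ∀ᶠ X : ℝ in atTop, ψ X ≤ X ^ (-t) := by
      filter_upwards [eventually_lt_of_lt_liminf ht2, eventually_gt_atTop 1] with X h1 hX
      exact rpow_neg_of_lt hX (hpos X (by linarith)) (by exact_mod_cast h1)
    have := dimH_E_le (s := s) (by exact_mod_cast hs0) (by exact_mod_cast ht1') hev
    rwa [ENNReal.ofReal_coe_nnreal] at this
  · refine (dimH_mono (Set.subset_univ _)).trans_eq ?_
    rw [Real.dimH_univ_eq_finrank, Complex.finrank_real_complex]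
    rfl
  · obtain ⟨s, hcs, hs⟩ := ENNReal.lt_iff_exists_nnreal_btwn.1 hc
    refine hcs.trans_le ?_
    rcases eq_or_ne s 0 with rfl | hs0'
    · exact zero_le
    have hs0 : 0 < s := pos_iff_ne_zero.2 hs0'
    have hs2 : s < 2 := by
      have := hs.trans_le (min_le_right _ _)
      exact_mod_cast this
    have hs0r : (0 : ℝ) < s := by exact_mod_cast hs0
    have hs2r : (s : ℝ) < 2 := by exact_mod_cast hs2
    have hL : (lowerOrder ψ).toENNReal < ((4 / s : NNReal) : ENNReal) := by
      rw [ENNReal.coe_div hs0', ENNReal.lt_div_iff_mul_lt (Or.inl (by exact_mod_cast hs0'))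
        (Or.inl (by simp)), mul_comm]
      have h1 := hs.trans_le (min_le_left _ _)
      rw [ENNReal.lt_div_iff_mul_lt (Or.inr (by simp)) (Or.inr (by exact_mod_cast hs0'))] at h1
      exact_mod_cast h1
    have hL' : lowerOrder ψ < (((4 / s : NNReal) : ℝ) : EReal) := by
      by_contra hcon
      have h1 := EReal.toENNReal_le_toENNReal (not_lt.1 hcon)
      rw [EReal.toENNReal_of_ne_top (x := (((4 / s : NNReal) : ℝ) : EReal)) (EReal.coe_ne_top _)] at h1
      simp only [EReal.toReal_coe, ENNReal.ofReal_coe_nnreal] at h1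
      exact absurd hL h1.not_gt
    have h2 : (((2 : ℝ)) : EReal) < (((4 / s : NNReal) : ℝ) : EReal) := by
      rw [EReal.coe_lt_coe_iff, NNReal.coe_div, lt_div_iff₀ hs0r]
      push_cast
      linarith
    -- `l` must exceed the lower order, so that `X ^ (-l) ≤ ψ X` frequently, and also 2, so that the
    -- balls are smaller than the scale `Q⁻²`. Both are compatible with `l < 4 / s` because `s < 2`.
    obtain ⟨l, hl1, hl2⟩ := EReal.lt_iff_exists_real_btwn.1 (max_lt hL' h2)
    have hl2' : l < ((4 / s : NNReal) : ℝ) := by exact_mod_cast hl2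
    rw [NNReal.coe_div, lt_div_iff₀ hs0r] at hl2'
    have hl : 2 < l := by
      have := (le_max_right _ _).trans_lt hl1
      exact_mod_cast this
    have hfreq : ∃ᶠ X : ℝ in atTop, X ^ (-l) ≤ ψ X := by
      have h3 := frequently_lt_of_liminf_lt (by isBoundedDefault) ((le_max_left _ _).trans_lt hl1)
      refine (h3.and_eventually (eventually_gt_atTop 1)).mono ?_
      rintro X ⟨h4, hX⟩
      exact rpow_neg_of_gt hX (hpos X (by linarith)) (by exact_mod_cast h4)
    have := le_dimH_E hanti hs0r hs2r hl (by exact_mod_cast hl2') hfreq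
    rwa [ENNReal.ofReal_coe_nnreal] at this

end Hurwitz
end

theorem theorem1 (ψ : ℝ → ℝ) (hpos : ∀ x, 0 < x → 0 < ψ x)
    (hanti : AntitoneOn ψ (Set.Ioi 0)) (hlim : Tendsto ψ atTop (𝓝 0)) :
    dimH (Hurwitz.E ψ) = min (4 / (Hurwitz.lowerOrder ψ).toENNReal) 2 ∧
      Packing.dimP (Hurwitz.E ψ) = 2 :=
  ⟨Hurwitz.dimH_E hpos hanti, Hurwitz.dimP_E hpos hanti⟩
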